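/- Let $n$ be a positive integer, let $\mathbf m=(m_1\le\dots\le m_n)$ be integers with $i\le m_i\le n$, and let $P=P(\mathbf m)$ be the natural unit interval order on $[n]=\{1,\dots,n\}$: $i<_P j$ if and only if $m_i<j$. Let $\mathrm{inc}(P)$ be the incomparability graph of $P$. For a word $w=w_1\cdots w_d$ on $[n]$: $i\in[d-1]$ is a $P$-descent if $w_i>_P w_{i+1}$; $w$ has no nontrivial left-to-right $P$-maxima if for each $2\le i\le d$ there is $j<i$ with $w_i\not>_P w_j$; $\mathrm{inv}_P(w)$ is the number of pairs $i<j$ such that $w_i,w_j$ are incomparable in $P$ and $w_i>w_j$; $w$ is of type $\mu\in\mathbb N^n$ if each letter $i$ appears $\mu_i$ times in $w$. Let $\mathcal U=\mathbb Z\langle u_1,\dots,u_n\rangle$ be the free associative algebra, $u_w=u_{w_1}\cdots u_{w_d}$, and let $\mathcal I_P$ be the two-sided ideal of $\mathcal U$ generated by $u_au_c-u_cu_a$ ($a<_P c$) and by $u_au_cu_b-u_bu_au_c$ ($a<b<c$, $a\not<_P b$, $b\not<_P c$, $a<_P c$). Put $\mathfrak e_k(\mathbf u)=\sum_{i_1>_P\cdots>_P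 i_k}u_{i_1}\cdots u_{i_k}$ (with $\mathfrak e_0=1$), define $\mathfrak h_k(\mathbf u)$ recursively by $\sum_{i=0}^k(-1)^i\mathfrak e_i(\mathbf u)\mathfrak h_{k-i}(\mathbf u)=\delta_{k,0}$, and for $k\ge1$ put $\mathfrak p_k(\mathbf u)=\sum_{i=1}^k(-1)^{i-1}\,i\,\mathfrak e_i(\mathbf u)\mathfrak h_{k-i}(\mathbf u)$. For $\mu\in\mathbb N^n$ let $X_P(\mathbf x,q;\mu)=\sum_\kappa q^{\mathrm{asc}(\kappa)}\prod_{i=1}^n\prod_{r\in\kappa(i)}x_r$, where $\kappa$ ranges over the maps from $[n]$ to finite subsets of $\{1,2,\dots\}$ with $|\kappa(i)|=\mu_i$ and $\kappa(i)\cap\kappa(j)=\emptyset$ whenever $\{i,j\}$ is an edge of $\mathrm{inc}(P)$, and $\mathrm{asc}(\kappa)$ is the number of pairs $((i,r),(j,s))$ with $\{i,j\}$ an edge, $i<j$, $r\in\kappa(i)$, $s\in\kappa(j)$, $r<s$. Let $\omega$ be the $\mathbb Q[q]$-algebra endomorphism of the ring of symmetric functions over $\mathbb Q[q]$ with $\omega(e_k)=h_k$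 for all $k\ge1$. For a partition $\lambda=(\lambda_1,\dots,\lambda_\ell)$ let $p_\lambda=p_{\lambda_1}\cdots p_{\lambda_\ell}$ be the power sum symmetric function and $z_\lambda=\prod_i i^{c_i}c_i!$, where $c_i$ is the number of parts of $\lambda$ equal to $i$. **Theorem.** (1) For every $k\ge1$, $\mathfrak p_k(\mathbf u)\equiv\sum_w u_w \pmod{\mathcal I_P}$, where $w$ ranges over all words of length $k$ with no $P$-descents and no nontrivial left-to-right $P$-maxima. (2) For every $\mu\in\mathbb N^n$, $X_P(\mathbf x,q;\mu)$ is a symmetric function and, with $d=\mu_1+\dots+\mu_n$, $$\omega X_P(\mathbf x,q;\mu)=\sum_{\lambda\vdash d}\frac1{z_\lambda}\,b_\lambda(q)\,p_\lambda(\mathbf x),\qquad b_\lambda(q)=\sum_{w\in\mathcal N_\lambda(\mu)}q^{\mathrm{inv}_P(w)},$$ where $\mathcal N_\lambda(\mu)$ is the set of words $w$ of type $\mu$ such that, when $w$ is split into consecutive subwords of lengths $\lambda_1,\dots,\lambda_\ell$, each subword has no $P$-descents and no nontrivial left-to-right $P$-maxima. Moreover these coefficients are the only ones: if $\omega X_P(\mathbf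 x,q;\mu)=\sum_\lambda z_\lambda^{-1}b_\lambda(q)p_\lambda(\mathbf x)$ is any finite expansion over partitions $\lambda$ (of any size) with $b_\lambda(q)\in\mathbb Q[q]$, then $b_\lambda(q)=\sum_{w\in\mathcal N_\lambda(\mu)}q^{\mathrm{inv}_P(w)}$ for every $\lambda$, where $\mathcal N_\lambda(\mu)=\emptyset$ if $|\lambda|\ne d$. -/

import Mathlib

open Polynomial

/-! ### Natural unit interval orders -/

/-- A weakly increasing sequence `m_1 ≤ ... ≤ m_n` with `i ≤ m_i ≤ n`, the letters `1, ..., n`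
being represented by `Fin n`. It encodes the natural unit interval order `P(m)` on the letters. -/
structure NUIO (n : ℕ) where
  m : Fin n → Fin n
  mono : Monotone m
  le_m : ∀ i, i ≤ m i

namespace NUIO

variable {n : ℕ} (P : NUIO n)

/-- The strict order of `P(m)`: `i <_P j` iff `m_i < j`. -/
def lt (i j : Fin n) : Prop := P.m i < j

instance : IsStrictOrder (Fin n) P.lt where
  irrefl i h := absurd (P.le_m i) (not_le.2 h)
  trans _ j _ hij hjk := (hij.trans_le (P.le_m j)).trans hjk

/-- The incomparability graph of `P`. -/
def inc : SimpleGraph (Fin n) where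
  Adj a b := a ≠ b ∧ ¬ P.lt a b ∧ ¬ P.lt b a
  symm := ⟨fun _ _ h => ⟨h.1.symm, h.2.2, h.2.1⟩⟩
  loopless := ⟨fun _ h => h.1 rfl⟩

end NUIO

/-! ### Words -/

/-- The finite set of words of length `k` on the alphabet `Fin n`. -/
def wordsOfLength (n k : ℕ) : Finset (List (Fin n)) :=
  (Finset.univ : Finset (Fin k → Fin n)).image List.ofFn

theorem mem_wordsOfLength {n k : ℕ} {w : List (Fin n)} :
    w ∈ wordsOfLength n k ↔ w.length = k := by
  simp only [wordsOfLength, Finset.mem_image, Finset.mem_univ, true_and]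
  constructor
  · rintro ⟨f, rfl⟩
    simp
  · rintro rfl
    exact ⟨w.get, List.ofFn_get w⟩

/-- `w` is of type `μ`: the letter `i` appears `μ i` times in `w`. -/
def HasType {n : ℕ} (μ : Fin n → ℕ) (w : List (Fin n)) : Prop := ∀ i, w.count i = μ i

namespace NUIO

variable {n : ℕ} (P : NUIO n)

/-- `w_1 >_P w_2 >_P ... >_P w_k`. -/
def IsDecreasing (w : List (Fin n)) : Prop :=
  ∀ (i : ℕ) (h : i + 1 < w.length), P.lt w[i + 1] w[i]

/-- `w` has no `P`-descents: there is no `i` with `w_i >_P w_{i+1}`. -/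
def NoDescents (w : List (Fin n)) : Prop :=
  ∀ (i : ℕ) (h : i + 1 < w.length), ¬ P.lt w[i + 1] w[i]

/-- `w` has no nontrivial left-to-right `P`-maxima: each letter `w_i` other than the first one
has some `w_j` with `j < i` and not `w_i >_P w_j`. -/
def NoNontrivialMaxima (w : List (Fin n)) : Prop :=
  ∀ i : Fin w.length, 0 < (i : ℕ) → ∃ j : Fin w.length, j < i ∧ ¬ P.lt (w.get j) (w.get i)

open Classical in
/-- The number of `P`-inversion pairs of `w`: positions `i < j` such that `w_i` and `w_j` are
incomparable in `P` and `w_i > w_j` in the natural order. -/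
noncomputable def inv (w : List (Fin n)) : ℕ :=
  (Finset.univ.filter fun p : Fin w.length × Fin w.length =>
    p.1 < p.2 ∧ P.inc.Adj (w.get p.1) (w.get p.2) ∧ w.get p.2 < w.get p.1).card

end NUIO

/-! ### Noncommutative `P`-symmetric functions -/

/-- The monomial `u_w` in the free associative `ℤ`-algebra on `u_1, ..., u_n`. -/
def uWord {n : ℕ} (w : List (Fin n)) : FreeAlgebra ℤ (Fin n) :=
  (w.map (FreeAlgebra.ι ℤ)).prod

namespace NUIO

variable {n : ℕ} (P : NUIO n)

/-- The two-sided ideal `I_P`. -/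
def ideal : TwoSidedIdeal (FreeAlgebra ℤ (Fin n)) :=
  TwoSidedIdeal.span
    ({x | ∃ a c : Fin n, P.lt a c ∧ x = uWord [a, c] - uWord [c, a]} ∪
     {x | ∃ a b c : Fin n, a < b ∧ b < c ∧ ¬ P.lt a b ∧ ¬ P.lt b c ∧ P.lt a c ∧
        x = uWord [a, c, b] - uWord [b, a, c]})

open Classical in
/-- The noncommutative `P`-elementary symmetric function, the sum of `u_w` over the words
`w_1 >_P ... >_P w_k`. -/
noncomputable def ncE (k : ℕ) : FreeAlgebra ℤ (Fin n) :=
  ∑ w ∈ (wordsOfLength n k).filter P.IsDecreasing, uWord w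

/-- The noncommutative `P`-complete homogeneous symmetric function, determined by `h_0 = 1` and
`h_k - e_1 h_{k-1} + ... + (-1)^k e_k = 0` for `k ≥ 1`. -/
noncomputable def ncH : ℕ → FreeAlgebra ℤ (Fin n)
  | 0 => 1
  | k + 1 => ∑ i : Fin (k + 1), (-1) ^ (i : ℕ) * (P.ncE (i + 1) * ncH (k - i))
decreasing_by omega

/-- The noncommutative `P`-power sum symmetric function
`p_k = e_1 h_{k-1} - 2 e_2 h_{k-2} + ... + (-1)^{k-1} k e_k`, for `k ≥ 1`. -/
noncomputable def ncP (k : ℕ) : FreeAlgebra ℤ (Fin n) :=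
  ∑ i ∈ Finset.Icc 1 k, (-1) ^ (i - 1) * ((i : FreeAlgebra ℤ (Fin n)) * (P.ncE i * P.ncH (k - i)))

/-- The defining relation of the noncommutative `h_k`, for `k ≥ 1`. -/
theorem ncH_relation (k : ℕ) :
    ∑ i ∈ Finset.range (k + 2), (-1) ^ i * (P.ncE i * P.ncH (k + 1 - i)) = 0 := by
  have h0 : P.ncE 0 = 1 := by
    have h1 : wordsOfLength n 0 = {[]} := by
      ext w
      simp [mem_wordsOfLength]
    have h2 : P.IsDecreasing [] := fun i h => by simp at h
    simp [ncE, h1, Finset.filter_singleton, h2, uWord]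
  have hk : P.ncH (k + 1) =
      ∑ i : Fin (k + 1), (-1) ^ (i : ℕ) * (P.ncE (i + 1) * P.ncH (k - i)) := by
    rw [ncH]
  rw [Finset.sum_range_succ', h0, Nat.sub_zero, hk, ← Fin.sum_univ_eq_sum_range
    (fun i => (-1) ^ (i + 1) * (P.ncE (i + 1) * P.ncH (k + 1 - (i + 1))))]
  simp [pow_succ, Finset.sum_neg_distrib]

end NUIO

/-! ### Symmetric functions -/

/-- Symmetric functions in countably many variables `x_0, x_1, ...` over `R`: formal power series
of bounded degree that are invariant under permutations of the variables. -/
def IsSymmetricFunction {R : Type*} [CommRing R] (f : MvPowerSeries ℕ R) : Prop :=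
  (∃ D : ℕ, ∀ m : ℕ →₀ ℕ, D < m.degree → MvPowerSeries.coeff m f = 0) ∧
  ∀ (σ : Equiv.Perm ℕ) (m : ℕ →₀ ℕ),
    MvPowerSeries.coeff (m.equivMapDomain σ) f = MvPowerSeries.coeff m f

section SymmetricFunctions

variable (R : Type*) [CommRing R]

open Classical in
/-- The elementary symmetric function `e_k`: the sum of all squarefree monomials of degree `k`. -/
noncomputable def symE (k : ℕ) : MvPowerSeries ℕ R :=
  fun m => if m.degree = k ∧ ∀ i, m i ≤ 1 then 1 else 0

open Classical in
/-- The complete homogeneous symmetric function `h_k`: the sum of all monomials of degree `k`. -/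
noncomputable def symH (k : ℕ) : MvPowerSeries ℕ R :=
  fun m => if m.degree = k then 1 else 0

open Classical in
/-- The power sum symmetric function `p_k`: the sum of all `x_i ^ k`, for `k ≥ 1`. -/
noncomputable def symP (k : ℕ) : MvPowerSeries ℕ R :=
  fun m => if ∃ i, m = Finsupp.single i k then 1 else 0

/-- The power sum symmetric function `p_λ = p_{λ_1} p_{λ_2} ...`. -/
noncomputable def symPPart {d : ℕ} (l : d.Partition) : MvPowerSeries ℕ R :=
  (l.parts.map (symP R)).prod

/-- The involution `ω` on symmetric functions. Every symmetric function is a unique polynomial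
`Q(e_1, e_2, ...)` in the elementary symmetric functions, and `ω` sends it to `Q(h_1, h_2, ...)`;
so `ω` is the algebra endomorphism with `ω(e_k) = h_k` for all `k ≥ 1`. Power series that are not
polynomials in `e_1, e_2, ...`, that is, not symmetric functions, get the value `0`. -/
noncomputable def omega (f : MvPowerSeries ℕ R) : MvPowerSeries ℕ R :=
  Function.extend
    (fun Q : MvPolynomial ℕ R => MvPolynomial.aeval (fun k => symE R (k + 1)) Q)
    (fun Q : MvPolynomial ℕ R => MvPolynomial.aeval (fun k => symH R (k + 1)) Q)
    0 f

/-- Setting all variables but the first `N` to zero turns `e_k` into the elementary symmetric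
polynomial in `N` variables. -/
theorem killCompl_symE (N k : ℕ) :
    MvPowerSeries.killCompl (R := R) Fin.valEmbedding (symE R k) =
      ((MvPolynomial.esymm (Fin N) R k : MvPolynomial (Fin N) R) : MvPowerSeries (Fin N) R) := by
  classical
  ext m
  have h1 : MvPowerSeries.coeff m (MvPowerSeries.killCompl (R := R) Fin.valEmbedding (symE R k)) =
      if m.degree = k ∧ ∀ i, m i ≤ 1 then 1 else 0 := by
    rw [MvPowerSeries.coeff_killCompl]
    change (if (m.embDomain Fin.valEmbedding).degree = k ∧
      ∀ i, m.embDomain Fin.valEmbedding i ≤ 1 then (1 : R) else 0) = _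
    have hd : (m.embDomain Fin.valEmbedding).degree = m.degree := by
      simp [Finsupp.degree_apply, Finsupp.support_embDomain, Finsupp.embDomain_apply_self,
        -Fin.valEmbedding_apply]
    have hi : (∀ i, m.embDomain Fin.valEmbedding i ≤ 1) ↔ ∀ i, m i ≤ 1 := by
      constructor
      · intro h i
        have := h (Fin.valEmbedding i)
        rwa [Finsupp.embDomain_apply_self] at this
      · intro h i
        by_cases hr : i ∈ Set.range (Fin.valEmbedding : Fin N ↪ ℕ)
        · obtain ⟨j, rfl⟩ := hr
          rw [Finsupp.embDomain_apply_self]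
          exact h j
        · rw [Finsupp.embDomain_of_notMem_range _ _ _ hr]
          exact Nat.zero_le 1
    simp only [hd, hi]
  rw [h1, MvPolynomial.coeff_coe, MvPolynomial.esymm_eq_sum_monomial, MvPolynomial.coeff_sum]
  simp only [MvPolynomial.coeff_monomial]
  have hs : ∀ (t : Finset (Fin N)) (i : Fin N),
      (∑ j ∈ t, Finsupp.single j 1 : Fin N →₀ ℕ) i = if i ∈ t then 1 else 0 := by
    intro t i
    simp [Finsupp.finsetSum_apply, Finsupp.single_apply]
  split_ifs with h
  · obtain ⟨hk, hm⟩ := h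
    have hval : ∀ i, m i = if i ∈ m.support then 1 else 0 := by
      intro i
      have := hm i
      split_ifs with hi
      · have := Finsupp.mem_support_iff.1 hi
        omega
      · simpa using hi
    have hsum : (∑ j ∈ m.support, Finsupp.single j 1 : Fin N →₀ ℕ) = m := by
      ext i
      rw [hs, ← hval]
    have hcard : m.support.card = k := by
      rw [← hk, Finsupp.degree, Finset.card_eq_sum_ones]
      refine Finset.sum_congr rfl fun i hi => ?_
      rw [hval i, if_pos hi]
    rw [Finset.sum_eq_single m.support]
    · rw [if_pos hsum]
    · intro t _ ht
      refine if_neg fun h' => ht ?_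
      ext i
      rw [Finsupp.mem_support_iff, ← h', hs]
      simp
    · intro h'
      exact absurd (Finset.mem_powersetCard.2 ⟨Finset.subset_univ _, hcard⟩) h'
  · refine (Finset.sum_eq_zero fun t ht => if_neg fun h' => h ?_).symm
    refine ⟨?_, fun i => ?_⟩
    · rw [← h', map_sum]
      simp [(Finset.mem_powersetCard.1 ht).2]
    · rw [← h', hs]
      split_ifs <;> simp

/-- The elementary symmetric functions `e_1, e_2, ...` are algebraically independent, so that the
polynomial `Q` in the definition of `ω` is unique. -/
theorem algebraicIndependent_symE :
    AlgebraicIndependent R (fun k => symE R (k + 1)) := by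
  change Function.Injective (MvPolynomial.aeval (fun k => symE R (k + 1)))
  rw [injective_iff_map_eq_zero]
  intro Q hQ
  obtain ⟨N, hN⟩ := Q.vars.bddAbove
  obtain ⟨Q', rfl⟩ := MvPolynomial.exists_rename_eq_of_vars_subset_range Q
    (Fin.val : Fin (N + 1) → ℕ) Fin.val_injective
    (fun i hi => ⟨⟨i, Nat.lt_succ_of_le (hN hi)⟩, rfl⟩)
  have key : (MvPowerSeries.killCompl (R := R) (Fin.valEmbedding (n := N + 1))).comp
      ((MvPolynomial.aeval (fun k => symE R (k + 1))).comp
        (MvPolynomial.rename (Fin.val : Fin (N + 1) → ℕ))) =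
      (MvPolynomial.coeToMvPowerSeries.algHom R).comp
        (MvPolynomial.aeval fun i : Fin (N + 1) =>
          MvPolynomial.esymm (Fin (N + 1)) R (i + 1)) := by
    ext1 i
    simp [killCompl_symE, MvPolynomial.coeToMvPowerSeries.algHom_apply]
  have h1 := DFunLike.congr_fun key Q'
  simp only [AlgHom.comp_apply, hQ, map_zero, MvPolynomial.coeToMvPowerSeries.algHom_apply,
    Algebra.algebraMap_self, MvPowerSeries.map_id, RingHom.id_apply] at h1
  rw [← MvPolynomial.esymmAlgHom_apply] at h1
  have h2 : (MvPolynomial.esymmAlgHom (Fin (N + 1)) R (N + 1) Q').val = 0 := by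
    apply MvPolynomial.coe_injective
    rw [← h1, MvPolynomial.coe_zero]
  have h3 : Q' = 0 := by
    apply MvPolynomial.esymmAlgHom_fin_injective R (le_refl (N + 1))
    rw [map_zero]
    exact Subtype.ext h2
  rw [h3, map_zero]

/-- `ω` sends `Q(e_1, e_2, ...)` to `Q(h_1, h_2, ...)`. -/
theorem omega_aeval (Q : MvPolynomial ℕ R) :
    omega R (MvPolynomial.aeval (fun k => symE R (k + 1)) Q) =
      MvPolynomial.aeval (fun k => symH R (k + 1)) Q :=
  Function.Injective.extend_apply (algebraicIndependent_symE R) _ _ Q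

end SymmetricFunctions

/-- `z_λ = ∏_i i ^ {m_i} m_i!`, where `m_i` is the number of parts of `λ` equal to `i`. -/
def zPart {d : ℕ} (l : d.Partition) : ℕ :=
  ∏ i ∈ l.parts.toFinset, i ^ l.parts.count i * (l.parts.count i).factorial

/-! ### Chromatic quasisymmetric functions -/

section Chromatic

variable {n : ℕ} (G : SimpleGraph (Fin n)) (μ : Fin n → ℕ)

/-- Proper multi-colorings of `G` of type `μ`, the colors being natural numbers. -/
def IsProperMultiColoring (κ : Fin n → Finset ℕ) : Prop :=
  (∀ i, (κ i).card = μ i) ∧ ∀ j k, G.Adj j k → Disjoint (κ j) (κ k)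

/-- The exponent of the monomial `x^κ = ∏_i ∏_{k ∈ κ(i)} x_k`. -/
noncomputable def colorExponent (κ : Fin n → Finset ℕ) : ℕ →₀ ℕ :=
  ∑ i, ∑ k ∈ κ i, Finsupp.single k 1

open Classical in
/-- `asc_G(κ)`: the number of pairs `((i, r), (j, s))` with `{i, j}` an edge, `i < j`,
`r ∈ κ(i)`, `s ∈ κ(j)` and `r < s`. -/
noncomputable def ascents (κ : Fin n → Finset ℕ) : ℕ :=
  ∑ p : Fin n × Fin n with G.Adj p.1 p.2 ∧ p.1 < p.2,
    ((κ p.1 ×ˢ κ p.2).filter fun c => c.1 < c.2).card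

open Classical in
/-- The chromatic quasisymmetric function `X_G(x, q; μ) = ∑_κ q^{asc_G(κ)} x^κ`, with coefficients
in `ℚ[q]`. The coefficient of `x^e` is the sum of `q^{asc_G(κ)}` over the proper multi-colorings
`κ` of type `μ` with `x^κ = x^e`; these use only colors in the support of `e`, so that they form a
finite set. -/
noncomputable def chromaticX : MvPowerSeries ℕ ℚ[X] :=
  fun e => ∑ κ ∈ (Fintype.piFinset fun _ : Fin n => e.support.powerset).filter
    (fun κ => IsProperMultiColoring G μ κ ∧ colorExponent κ = e), X ^ ascents G κ

end Chromatic

/-! ### The power sum coefficients -/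

namespace NUIO

variable {n : ℕ} (P : NUIO n)

open Classical in
/-- The words of length `k` with no `P`-descents and no nontrivial left-to-right `P`-maxima. -/
noncomputable def goodWords (k : ℕ) : Finset (List (Fin n)) :=
  (wordsOfLength n k).filter fun w => P.NoDescents w ∧ P.NoNontrivialMaxima w

open Classical in
/-- The set `N_λ(μ)` of words of type `μ` that split into consecutive subwords of lengths
`λ_1 ≥ λ_2 ≥ ...`, each of them with no `P`-descents and no nontrivial left-to-right `P`-maxima.
It is empty unless `|λ| = |μ|`. -/
noncomputable def splitWords (μ : Fin n → ℕ) {d : ℕ} (l : d.Partition) : Finset (List (Fin n)) :=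
  (wordsOfLength n d).filter fun w => HasType μ w ∧
    ∀ s ∈ (l.parts.sort (· ≥ ·)).splitLengths w, P.NoDescents s ∧ P.NoNontrivialMaxima s

/-- The sum of `q^{inv_P(w)}` over the words in `N_λ(μ)`. -/
noncomputable def powerCoeff (μ : Fin n → ℕ) {d : ℕ} (l : d.Partition) : ℚ[X] :=
  ∑ w ∈ P.splitWords μ l, X ^ P.inv w

end NUIO

/-! ### Weighted sums over words -/

section WordSums

variable {n : ℕ} {R : Type*} [Ring R] (u : Fin n → R)

/-! Part (1) is an identity of power series in a central variable t over any ring in which u_a and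
u_c commute whenever a <_P c. For the first j letters let D_j be the series of P-decreasing words
with sign (-1)^length, and G_j the series of nonempty words without P-descents and nontrivial maxima
("good" words). The claim is G_j D_j = -t D_j', proved by adding one letter c at a time. Write f for
the number of letters below c; these are the first f letters. Then D_{c+1} = D_c - t u_c D_f, and
cutting a good word at its last c gives G_{c+1} = G_c + (1 + G_{c+1} - G_f) T_c, where T_c is the
series of descent-free words c v with all letters of v less than c. A sign cancellation yields T_c
D_c = t u_c D_f, and since G_f commutes with u_c the recursion closes (`goodSeries_mul_decSeries`).
Multiplying by the inverse H of D_n gives the formula for the power sums.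

For part (2), the triple relations of the ideal make the e_k commute modulo the ideal
(`elemSum_lie_symm`), so they generate a commutative ring A, in which Newton's identities make the
good-word sums the power sums p_k. The linear map u_w ↦ q^inv(w) on words of type μ (and 0 on the
others) vanishes on the ideal (`wordEval_ideal`), hence defines an additive map Ψ on A. Expanding
products of the e_k over color classes shows that Ψ(∏ e_{m_r}) is the coefficient of x^m in X_P
(`wordEval_elemProd`), and expanding products of good-word sums shows that Ψ(p_λ) is the required
coefficient. Symmetry of X_P is now the commutativity of A.

The dual Cauchy identity, with Ψ applied to its coefficients, reads X_P = ∑ sign(λ) z_λ⁻¹ Ψ(p_λ)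
p_λ(x) (`elemSeries_eq_sum`). Since ω multiplies p_λ by sign(λ), the signs cancel. Uniqueness is the
linear independence of the p_λ over ℚ[q], which reduces to the algebraic independence of the
elementary functions. -/

theorem wordsOfLength_zero : wordsOfLength n 0 = {[]} := by
  ext w
  simp [mem_wordsOfLength]

theorem sum_wordsOfLength_succ {M : Type*} [AddCommMonoid M] (f : List (Fin n) → M) (k : ℕ) :
    ∑ w ∈ wordsOfLength n (k + 1), f w = ∑ a, ∑ w ∈ wordsOfLength n k, f (a :: w) := by
  rw [← Finset.sum_product']
  symm
  refine Finset.sum_bij (fun p _ => p.1 :: p.2) ?_ ?_ ?_ ?_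
  · simp [mem_wordsOfLength]
  · rintro ⟨a, w⟩ _ ⟨b, v⟩ _ h
    simpa using h
  · intro w hw
    rw [mem_wordsOfLength] at hw
    match w, hw with
    | a :: w, hw => exact ⟨(a, w), by simpa [mem_wordsOfLength] using hw, rfl⟩
  · simp

/-- The sum of `α w • u_w` over all words `w` of length `k`. -/
def wordSum (α : List (Fin n) → ℤ) (k : ℕ) : R :=
  ∑ w ∈ wordsOfLength n k, α w • (w.map u).prod

theorem wordSum_zero (α : List (Fin n) → ℤ) : wordSum u α 0 = α [] • (1 : R) := by
  simp [wordSum, wordsOfLength_zero]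

theorem wordSum_succ (α : List (Fin n) → ℤ) (k : ℕ) :
    wordSum u α (k + 1) = ∑ a, u a * wordSum u (fun w => α (a :: w)) k := by
  simp only [wordSum, sum_wordsOfLength_succ, Finset.mul_sum, List.map_cons, List.prod_cons,
    mul_smul_comm]

theorem wordSum_add (α β : List (Fin n) → ℤ) (k : ℕ) :
    wordSum u (fun w => α w + β w) k = wordSum u α k + wordSum u β k := by
  simp [wordSum, add_smul, Finset.sum_add_distrib]

theorem wordSum_sub (α β : List (Fin n) → ℤ) (k : ℕ) :
    wordSum u (fun w => α w - β w) k = wordSum u α k - wordSum u β k := by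
  simp [wordSum, sub_smul, Finset.sum_sub_distrib]

theorem wordSum_const_mul (c : ℤ) (α : List (Fin n) → ℤ) (k : ℕ) :
    wordSum u (fun w => c * α w) k = c • wordSum u α k := by
  simp only [wordSum, mul_smul, Finset.smul_sum]

theorem wordSum_eq_zero {α : List (Fin n) → ℤ} {k : ℕ} (h : ∀ w, w.length = k → α w = 0) :
    wordSum u α k = 0 :=
  Finset.sum_eq_zero fun w hw => by rw [h w (mem_wordsOfLength.1 hw), zero_smul]

/-- The product of two weights: the sum over all factorizations of a word. -/
def splitMul (α β : List (Fin n) → ℤ) (w : List (Fin n)) : ℤ :=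
  ∑ i ∈ Finset.range (w.length + 1), α (w.take i) * β (w.drop i)

theorem splitMul_cons (α β : List (Fin n) → ℤ) (a : Fin n) (w : List (Fin n)) :
    splitMul α β (a :: w) = α [] * β (a :: w) + splitMul (fun v => α (a :: v)) β w := by
  rw [splitMul, List.length_cons, Finset.sum_range_succ', add_comm]
  simp [splitMul]

theorem wordSum_splitMul (α β : List (Fin n) → ℤ) (k : ℕ) :
    wordSum u (splitMul α β) k =
      ∑ p ∈ Finset.HasAntidiagonal.antidiagonal k, wordSum u α p.1 * wordSum u β p.2 := by
  induction k generalizing α with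
  | zero => simp [wordSum_zero, splitMul, mul_smul]
  | succ k ih =>
    rw [Finset.Nat.antidiagonal_succ, Finset.sum_cons, Finset.sum_map, wordSum_succ]
    simp only [splitMul_cons, wordSum_add, wordSum_const_mul, ih, Function.Embedding.prodMap,
      Function.Embedding.coeFn_mk, Prod.map, Function.Embedding.refl_apply, wordSum_zero,
      Nat.succ_eq_add_one, wordSum_succ, mul_add, Finset.sum_add_distrib, Finset.sum_mul]
    rw [Finset.sum_comm]
    simp only [Finset.mul_sum, mul_assoc, smul_mul_assoc, one_mul, mul_smul_comm]

/-- The generating series of a weight on words. -/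
noncomputable def wordSeries (α : List (Fin n) → ℤ) : PowerSeries R :=
  PowerSeries.mk (wordSum u α)

@[simp]
theorem coeff_wordSeries (α : List (Fin n) → ℤ) (k : ℕ) :
    PowerSeries.coeff k (wordSeries u α) = wordSum u α k :=
  PowerSeries.coeff_mk _ _

theorem wordSeries_mul (α β : List (Fin n) → ℤ) :
    wordSeries u α * wordSeries u β = wordSeries u (splitMul α β) := by
  ext k
  simp [PowerSeries.coeff_mul, wordSum_splitMul]

theorem wordSeries_add (α β : List (Fin n) → ℤ) :
    wordSeries u (fun w => α w + β w) = wordSeries u α + wordSeries u β := by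
  ext k
  simp [wordSum_add]

theorem wordSeries_sub (α β : List (Fin n) → ℤ) :
    wordSeries u (fun w => α w - β w) = wordSeries u α - wordSeries u β := by
  ext k
  simp [wordSum_sub]

theorem wordSeries_nil : wordSeries u (fun w => if w = [] then 1 else 0) = 1 := by
  ext k
  rw [coeff_wordSeries, PowerSeries.coeff_one]
  split_ifs with h
  · subst h
    simp [wordSum_zero]
  · refine wordSum_eq_zero u fun w hw => if_neg ?_
    rintro rfl
    exact h hw.symm

open Classical in
/-- The series of the weight supported on words starting with the letter `c`. -/
theorem wordSeries_cons (c : Fin n) (α β : List (Fin n) → ℤ) (h0 : α [] = 0)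
    (h : ∀ a w, α (a :: w) = if a = c then β w else 0) :
    wordSeries u α = PowerSeries.X * (PowerSeries.C (u c) * wordSeries u β) := by
  ext k
  cases k with
  | zero => simp [wordSum_zero, h0]
  | succ k =>
    rw [PowerSeries.coeff_succ_X_mul, PowerSeries.coeff_C_mul, coeff_wordSeries, coeff_wordSeries,
      wordSum_succ, Finset.sum_eq_single c]
    · simp [h]
    · intro a _ hac
      rw [wordSum_eq_zero, mul_zero]
      simp [h, hac]
    · simp

end WordSums

/-! ### Decreasing words and good words -/

namespace NUIO

variable {n : ℕ} (P : NUIO n)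

theorem lt_of_Plt {P : NUIO n} {i j : Fin n} (h : P.lt i j) : i < j := (P.le_m i).trans_lt h

theorem not_lt_of_le {i j : Fin n} (h : i ≤ j) : ¬ P.lt j i := fun h' => (lt_of_Plt h').not_ge h

/-- The number of letters below `j` in the order `P`; they form an initial segment. -/
noncomputable def below (j : Fin n) : ℕ := sInf {k | ∀ i, P.lt i j → i.val < k}

theorem below_le (j : Fin n) : P.below j ≤ j :=
  Nat.sInf_le fun _ hi => lt_of_Plt hi

theorem lt_iff_below {i j : Fin n} : P.lt i j ↔ i.val < P.below j := by
  constructor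
  · have h : P.below j ∈ {k | ∀ i, P.lt i j → i.val < k} := Nat.sInf_mem ⟨n, fun i _ => i.2⟩
    exact h i
  · intro h
    by_contra h'
    refine h.not_ge (Nat.sInf_le fun i' hi' => ?_)
    by_contra h''
    exact h' ((P.mono (not_lt.1 h'')).trans_lt hi')

theorem below_mono : Monotone P.below := by
  intro i j hij
  by_contra! h
  have hj : P.below j < n := h.trans_le ((P.below_le i).trans i.2.le)
  have h1 : P.lt ⟨P.below j, hj⟩ i := P.lt_iff_below.2 h
  exact lt_irrefl _ (P.lt_iff_below.1 (lt_of_lt_of_le (show P.m _ < i from h1) hij))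

theorem isDecreasing_iff {w : List (Fin n)} :
    P.IsDecreasing w ↔ w.Pairwise fun a b => P.lt b a := by
  have : Trans (fun a b => P.lt b a) (fun a b => P.lt b a) (fun a b => P.lt b a) :=
    ⟨fun h1 h2 => _root_.trans (r := P.lt) h2 h1⟩
  rw [← List.isChain_iff_pairwise, List.isChain_iff_getElem]
  rfl

theorem noDescents_iff {w : List (Fin n)} :
    P.NoDescents w ↔ w.IsChain fun a b => ¬ P.lt b a := by
  rw [List.isChain_iff_getElem]
  rfl

theorem noNontrivialMaxima_iff {w : List (Fin n)} :
    P.NoNontrivialMaxima w ↔ ∀ (i : ℕ) (hi : i < w.length), 0 < i →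
      ∃ (j : ℕ) (hj : j < i), ¬ P.lt (w[j]'(hj.trans hi)) w[i] := by
  constructor
  · intro h i hi h0
    obtain ⟨j, hj, h'⟩ := h ⟨i, hi⟩ h0
    exact ⟨j, hj, h'⟩
  · intro h i h0
    obtain ⟨j, hj, h'⟩ := h i i.2 h0
    exact ⟨⟨j, hj.trans i.2⟩, hj, h'⟩

theorem noNontrivialMaxima_append_singleton {w : List (Fin n)} {x : Fin n} :
    P.NoNontrivialMaxima (w ++ [x]) ↔
      P.NoNontrivialMaxima w ∧ (w ≠ [] → ∃ y ∈ w, ¬ P.lt y x) := by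
  simp only [noNontrivialMaxima_iff]
  constructor
  · intro h
    refine ⟨fun i hi h0 => ?_, fun hw => ?_⟩
    · obtain ⟨j, hj, h'⟩ := h i (by simp; omega) h0
      rw [List.getElem_append_left (hj.trans hi), List.getElem_append_left hi] at h'
      exact ⟨j, hj, h'⟩
    · obtain ⟨j, hj, h'⟩ := h w.length (by simp) (List.length_pos_iff.2 hw)
      rw [List.getElem_append_left hj, List.getElem_concat_length rfl] at h'
      exact ⟨_, List.getElem_mem hj, h'⟩
  · rintro ⟨h1, h2⟩ i hi h0
    rcases Nat.lt_or_ge i w.length with hi' | hi'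
    · obtain ⟨j, hj, h'⟩ := h1 i hi' h0
      refine ⟨j, hj, ?_⟩
      rwa [List.getElem_append_left (hj.trans hi'), List.getElem_append_left hi']
    · obtain rfl : i = w.length := by simp at hi; omega
      obtain ⟨y, hy, h'⟩ := h2 (List.length_pos_iff.1 h0)
      obtain ⟨j, hj, rfl⟩ := List.getElem_of_mem hy
      refine ⟨j, hj, ?_⟩
      rwa [List.getElem_append_left hj, List.getElem_concat_length rfl]

/-- A letter after c that is less than c cannot be P-above c, so it is never a nontrivial maximum.
-/
theorem noNontrivialMaxima_append_cons {a v : List (Fin n)} {c : Fin n} (hv : ∀ x ∈ v, x < c) :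
    P.NoNontrivialMaxima (a ++ c :: v) ↔ P.NoNontrivialMaxima (a ++ [c]) := by
  induction v using List.reverseRecOn with
  | nil => rfl
  | append_singleton v x ih =>
    rw [show a ++ c :: (v ++ [x]) = (a ++ c :: v) ++ [x] by simp,
      noNontrivialMaxima_append_singleton, ih fun y hy => hv y (by simp [hy])]
    refine and_iff_left fun _ => ⟨c, by simp, P.not_lt_of_le (hv x (by simp)).le⟩

/-- Nonempty words in the first `j` letters without `P`-descents and without nontrivial
left-to-right `P`-maxima. -/
def IsGood (j : ℕ) (w : List (Fin n)) : Prop :=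
  w ≠ [] ∧ P.NoDescents w ∧ P.NoNontrivialMaxima w ∧ ∀ x ∈ w, x.val < j

/-- Cutting just before the last occurrence of the largest letter c decouples the conditions: no
descent can end in c, no letter of v can be a maximum, and c itself is not a nontrivial maximum
exactly when a is empty or has a letter that is not P-below c. -/
theorem isGood_append_cons {a v : List (Fin n)} {c : Fin n} (ha : ∀ x ∈ a, x ≤ c)
    (hv : ∀ x ∈ v, x < c) :
    P.IsGood (c + 1) (a ++ c :: v) ↔ P.NoDescents (c :: v) ∧
      (a = [] ∨ P.IsGood (c + 1) a ∧ ¬ ∀ x ∈ a, x.val < P.below c) := by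
  have h1 : P.NoDescents (a ++ c :: v) ↔ P.NoDescents a ∧ P.NoDescents (c :: v) := by
    simp only [noDescents_iff, List.isChain_append]
    refine and_congr_right fun _ => and_iff_left fun x hx y hy => ?_
    obtain rfl : c = y := by simpa using hy
    exact P.not_lt_of_le (ha x (List.mem_of_mem_getLast? hx))
  have h2 : ∀ x ∈ a ++ c :: v, x.val < c + 1 := by
    intro x hx
    rcases List.mem_append.1 hx with h | h
    · exact Nat.lt_succ_of_le (ha x h)
    · rcases List.mem_cons.1 h with rfl | h
      · omega
      · exact (show x.val < c from hv x h).trans (Nat.lt_succ_self _)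
  have h3 : ∀ x ∈ a, x.val < c + 1 := fun x hx => Nat.lt_succ_of_le (ha x hx)
  have h4 : P.NoNontrivialMaxima [] := fun i => i.elim0
  have h5 : P.NoDescents [] := fun i h => by simp at h
  simp only [IsGood, h1, noNontrivialMaxima_append_cons P hv, noNontrivialMaxima_append_singleton,
    lt_iff_below]
  by_cases ha' : a = []
  · subst ha'
    have h6 : ([] : List (Fin n)) ++ c :: v ≠ [] := by simp
    tauto
  · have h6 : a ++ c :: v ≠ [] := by simp
    have h7 : (∀ x ∈ a, x.val < P.below c) ↔ ¬ ∃ y ∈ a, ¬ y.val < P.below c := by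
      push Not
      rfl
    tauto

theorem ite_and_eq_mul {p q : Prop} [Decidable (p ∧ q)] [Decidable p] [Decidable q] :
    (if p ∧ q then (1 : ℤ) else 0) = (if p then 1 else 0) * if q then 1 else 0 := by
  by_cases hp : p <;> by_cases hq : q <;> simp [hp, hq]

/-- Both cuts are made at the last occurrence of c. -/
theorem append_cons_inj {α : Type*} {c : α} {a v a' v' : List α} (hv : c ∉ v) (hv' : c ∉ v')
    (h : a ++ c :: v = a' ++ c :: v') : a = a' := by
  have key : ∀ {a v a' v' : List α}, c ∉ v → c ∉ v' →
      ∀ as : List α, a' = a ++ as → c :: v = as ++ c :: v' → a = a' := by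
    intro a v a' v' hv _ as h1 h2
    cases as with
    | nil => simpa using h1.symm
    | cons b as =>
      rw [List.cons_append, List.cons.injEq] at h2
      exact absurd (h2.2 ▸ by simp) hv
  rcases List.append_eq_append_iff.1 h with ⟨as, h1, h2⟩ | ⟨as, h1, h2⟩
  · exact key hv hv' as h1 h2
  · exact (key hv' hv as h1 h2).symm

open Classical in
/-- The weight of the words counted, with signs, by `E(-t)`, in the first `j` letters. -/
noncomputable def decWeight (j : ℕ) (w : List (Fin n)) : ℤ :=
  if P.IsDecreasing w ∧ ∀ x ∈ w, x.val < j then (-1) ^ w.length else 0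

open Classical in
/-- The indicator of good words in the first `j` letters. -/
noncomputable def goodWeight (j : ℕ) (w : List (Fin n)) : ℤ :=
  if P.IsGood j w then 1 else 0

open Classical in
/-- The indicator of words `c v` without `P`-descents, where all letters of `v` are less than
`c`. -/
noncomputable def topWeight (c : Fin n) (w : List (Fin n)) : ℤ :=
  if ∃ v, w = c :: v ∧ P.NoDescents w ∧ ∀ x ∈ v, x < c then 1 else 0

-- The usual cancellation between descent-free prefixes and decreasing suffixes. If d <_P c, only
-- the cut directly after c survives. Otherwise that cut contributes the opposite of what, by
-- induction, all later cuts contribute together.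
open Classical in
theorem sum_noDescents_isDecreasing (c : Fin n) (x : List (Fin n)) :
    splitMul (fun v => if P.NoDescents (c :: v) then 1 else 0)
      (fun v => if P.IsDecreasing v then (-1) ^ v.length else 0) x =
    if P.IsDecreasing (c :: x) then (-1) ^ x.length else 0 := by
  have h1 : ∀ c : Fin n, P.NoDescents [c] := fun c i h => by simp at h
  induction x generalizing c with
  | nil =>
    have h2 : P.IsDecreasing [] := fun i h => by simp at h
    have h3 : P.IsDecreasing [c] := fun i h => by simp at h
    simp [splitMul, h1, h2, h3]
  | cons d x ih =>
    rw [splitMul_cons, if_pos (h1 c)]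
    have hnd : ∀ v, P.NoDescents (c :: d :: v) ↔ ¬ P.lt d c ∧ P.NoDescents (d :: v) := by
      simp [noDescents_iff]
    have hd : P.IsDecreasing (c :: d :: x) ↔ P.lt d c ∧ P.IsDecreasing (d :: x) := by
      simp only [IsDecreasing, ← List.isChain_iff_getElem (R := fun a b => P.lt b a)]
      simp
    simp only [hnd, hd]
    by_cases h : P.lt d c
    · simp [h, splitMul]
    · simp only [h, not_false_eq_true, true_and, ih, List.length_cons, pow_succ]
      by_cases h' : P.IsDecreasing (d :: x) <;> simp [h']

theorem isDecreasing_cons_iff {c : Fin n} {x : List (Fin n)} :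
    P.IsDecreasing (c :: x) ↔ P.IsDecreasing x ∧ ∀ y ∈ x, y.val < P.below c := by
  simp only [isDecreasing_iff, List.pairwise_cons, lt_iff_below, and_comm]

-- The coefficient form of T_c D_c = t u_c D_f: what survives the cancellation are the decreasing
-- words c x, and decreasing means that all of x lies P-below c.
open Classical in
theorem splitMul_topWeight_decWeight (c : Fin n) (a : Fin n) (x : List (Fin n)) :
    splitMul (P.topWeight c) (P.decWeight c) (a :: x) =
      if a = c then P.decWeight (P.below c) x else 0 := by
  rw [splitMul_cons]
  have h0 : P.topWeight c [] = 0 := if_neg (by simp)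
  rw [h0, zero_mul, zero_add]
  split_ifs with hac
  · subst hac
    by_cases hx : ∀ y ∈ x, y < a
    · have h1 : splitMul (fun v => P.topWeight a (a :: v)) (P.decWeight a) x =
          splitMul (fun v => if P.NoDescents (a :: v) then 1 else 0)
            (fun v => if P.IsDecreasing v then (-1) ^ v.length else 0) x := by
        refine Finset.sum_congr rfl fun i _ => ?_
        have h2 : ∀ y ∈ x.take i, y < a := fun y hy => hx y (List.mem_of_mem_take hy)
        have h3 : ∀ y ∈ x.drop i, y.val < a := fun y hy => hx y (List.mem_of_mem_drop hy)
        have h4 : P.topWeight a (a :: x.take i) =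
            if P.NoDescents (a :: x.take i) then 1 else 0 := by
          unfold topWeight
          refine if_congr ⟨?_, fun h => ⟨_, rfl, h, h2⟩⟩ rfl rfl
          rintro ⟨v, -, h, -⟩
          exact h
        have h5 : P.decWeight a (x.drop i) =
            if P.IsDecreasing (x.drop i) then (-1) ^ (x.drop i).length else 0 := by
          unfold decWeight
          exact if_congr (and_iff_left h3) rfl rfl
        simp only [h4, h5]
      rw [h1, sum_noDescents_isDecreasing]
      exact if_congr P.isDecreasing_cons_iff rfl rfl
    · have h1 : splitMul (fun v => P.topWeight a (a :: v)) (P.decWeight a) x = 0 := by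
        refine Finset.sum_eq_zero fun i _ => ?_
        by_contra h
        have h2 := left_ne_zero_of_mul h
        have h3 := right_ne_zero_of_mul h
        simp only [topWeight, ne_eq, ite_eq_right_iff, one_ne_zero, imp_false, not_not] at h2
        obtain ⟨v, hv, -, hv'⟩ := h2
        rw [List.cons.injEq] at hv
        simp only [decWeight, ne_eq, ite_eq_right_iff, not_forall] at h3
        obtain ⟨⟨-, h3⟩, -⟩ := h3
        refine hx fun y hy => ?_
        rw [← List.take_append_drop i x, List.mem_append] at hy
        rcases hy with hy | hy
        · exact hv' y (hv.2 ▸ hy)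
        · exact h3 y hy
      rw [h1]
      symm
      refine if_neg fun h => hx fun y hy => ?_
      exact (h.2 y hy).trans_le (P.below_le a)
  · refine Finset.sum_eq_zero fun i _ => mul_eq_zero_of_left (if_neg ?_) _
    rintro ⟨v, h, -⟩
    rw [List.cons.injEq] at h
    exact hac h.1

-- A decreasing word in letters up to c that uses c must start with it, and its remaining letters
-- are P-below c. The extra letter accounts for the sign.
open Classical in
theorem decWeight_sub_cons (c a : Fin n) (x : List (Fin n)) :
    P.decWeight c (a :: x) - P.decWeight (c + 1) (a :: x) =
      if a = c then P.decWeight (P.below c) x else 0 := by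
  by_cases hac : a = c
  · subst hac
    have h1 : P.decWeight a (a :: x) = 0 := if_neg fun h => lt_irrefl _ (h.2 a (by simp))
    have h2 : P.decWeight (a + 1) (a :: x) = - P.decWeight (P.below a) x := by
      have h3 : (P.IsDecreasing (a :: x) ∧ ∀ y ∈ a :: x, y.val < a + 1) ↔
          P.IsDecreasing x ∧ ∀ y ∈ x, y.val < P.below a := by
        rw [isDecreasing_cons_iff]
        refine and_iff_left_of_imp ?_
        rintro ⟨-, h⟩ y hy
        rcases List.mem_cons.1 hy with rfl | hy
        · exact Nat.lt_succ_self _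
        · exact ((h y hy).trans_le (P.below_le a)).trans (Nat.lt_succ_self _)
      unfold decWeight
      rw [if_congr h3 rfl rfl, List.length_cons, pow_succ]
      split_ifs <;> simp
    rw [h1, h2, if_pos rfl, zero_sub, neg_neg]
  · rw [if_neg hac, sub_eq_zero]
    unfold decWeight
    refine if_congr (and_congr_right fun h => ?_) rfl rfl
    have h' := ((P.isDecreasing_cons_iff).1 h).2
    have hne : a.val ≠ c.val := fun h => hac (Fin.ext h)
    constructor
    · exact fun h y hy => (h y hy).trans (Nat.lt_succ_self _)
    · intro h y hy
      have ha : a.val < c := by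
        have := h a (by simp)
        omega
      rcases List.mem_cons.1 hy with rfl | hy
      · exact ha
      · exact ((h' y hy).trans_le (P.below_le a)).trans ha

/-- A good word either avoids c or is cut uniquely before its last c. By `isGood_append_cons` the
left factor is empty, or good but not entirely P-below c; this is the weight 1 + G_{c+1} - G_f. -/
theorem goodWeight_succ (c : Fin n) (w : List (Fin n)) :
    P.goodWeight (c + 1) w = P.goodWeight c w +
      splitMul (fun v => (if v = [] then 1 else 0) + P.goodWeight (c + 1) v -
        P.goodWeight (P.below c) v) (P.topWeight c) w := by
  classical
  have hw : ∀ v, (if v = [] then 1 else 0) + P.goodWeight (c + 1) v - P.goodWeight (P.below c) v =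
      if v = [] ∨ P.IsGood (c + 1) v ∧ ¬ ∀ x ∈ v, x.val < P.below c then 1 else 0 := by
    intro v
    have h1 : P.IsGood (P.below c) v ↔ P.IsGood (c + 1) v ∧ ∀ x ∈ v, x.val < P.below c := by
      constructor
      · rintro ⟨h1, h2, h3, h4⟩
        exact ⟨⟨h1, h2, h3, fun x hx => ((h4 x hx).trans_le (P.below_le c)).trans
          (Nat.lt_succ_self _)⟩, h4⟩
      · rintro ⟨⟨h1, h2, h3, -⟩, h4⟩
        exact ⟨h1, h2, h3, h4⟩
    have h2 : P.IsGood (c + 1) v → v ≠ [] := fun h => h.1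
    unfold goodWeight
    rw [if_congr h1 rfl rfl]
    by_cases hv : v = []
    · simp [hv, IsGood]
    · by_cases h4 : P.IsGood (c + 1) v <;>
        by_cases h5 : ∀ x ∈ v, x.val < P.below c
      · rw [if_neg hv, if_pos h4, if_pos ⟨h4, h5⟩, if_neg (by tauto)]
        norm_num
      · rw [if_neg hv, if_pos h4, if_neg (by tauto), if_pos (by tauto)]
        norm_num
      · rw [if_neg hv, if_neg h4, if_neg (by tauto), if_neg (by tauto)]
        norm_num
      · rw [if_neg hv, if_neg h4, if_neg (by tauto), if_neg (by tauto)]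
        norm_num
  simp only [hw]
  by_cases hcw : c ∈ w
  · obtain ⟨v, a, h1, hv⟩ := List.eq_append_cons_of_mem (List.mem_reverse.2 hcw)
    obtain ⟨a, v, rfl, hv⟩ : ∃ a v, w = a ++ c :: v ∧ c ∉ v :=
      ⟨a.reverse, v.reverse, by rw [← List.reverse_reverse w, h1]; simp, by simpa using hv⟩
    have h0 : P.goodWeight c (a ++ c :: v) = 0 := if_neg fun h => lt_irrefl _ (h.2.2.2 c (by simp))
    -- `topWeight` requires the right factor to start with c and contain no other c, so only the cut
    -- before the last c contributes.
    rw [h0, zero_add, splitMul, Finset.sum_eq_single a.length]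
    · rw [List.take_left, List.drop_left]
      by_cases hac : (∀ x ∈ a, x ≤ c) ∧ ∀ x ∈ v, x < c
      · have h2 : P.topWeight c (c :: v) = if P.NoDescents (c :: v) then 1 else 0 := by
          unfold topWeight
          refine if_congr ⟨?_, fun h => ⟨_, rfl, h, hac.2⟩⟩ rfl rfl
          rintro ⟨v, -, h, -⟩
          exact h
        rw [h2, goodWeight, if_congr (P.isGood_append_cons hac.1 hac.2) rfl rfl]
        rw [mul_comm, ite_and_eq_mul]
      · rw [goodWeight, if_neg]
        · symm
          by_contra h
          have h2 := left_ne_zero_of_mul h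
          have h3 := right_ne_zero_of_mul h
          simp only [topWeight, ne_eq, ite_eq_right_iff, one_ne_zero, imp_false, not_not] at h2 h3
          obtain ⟨v', hv', -, h3⟩ := h3
          rw [List.cons.injEq] at hv'
          rw [← hv'.2] at h3
          refine hac ⟨fun x hx => ?_, h3⟩
          rcases h2 with rfl | h2
          · simp at hx
          · exact Nat.lt_succ_iff.1 (h2.1.2.2.2 x hx)
        · intro h
          refine hac ⟨fun x hx => Nat.lt_succ_iff.1 (h.2.2.2 x (by simp [hx])), fun x hx => ?_⟩
          refine lt_of_le_of_ne (Nat.lt_succ_iff.1 (h.2.2.2 x (by simp [hx]))) ?_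
          rintro rfl
          exact hv hx
    · intro i hi hia
      rw [show P.topWeight c _ = 0 from if_neg ?_, mul_zero]
      rintro ⟨v', h2, -, h3⟩
      have h4 : c ∉ v' := fun h => lt_irrefl _ (h3 c h)
      have h5 := append_cons_inj (a' := (a ++ c :: v).take i) hv h4
        (by rw [← h2, List.take_append_drop])
      apply hia
      rw [h5, List.length_take, min_eq_left]
      exact Nat.lt_succ_iff.1 (Finset.mem_range.1 hi)
    · intro h
      exact absurd (Finset.mem_range.2 (by simp)) h
  · have h0 : splitMul (fun v => if v = [] ∨ P.IsGood (c + 1) v ∧ ¬ ∀ x ∈ v, x.val < P.below c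
        then 1 else 0) (P.topWeight c) w = 0 := by
      refine Finset.sum_eq_zero fun i _ => ?_
      rw [show P.topWeight c _ = 0 from if_neg ?_, mul_zero]
      rintro ⟨v, h, -⟩
      exact hcw (List.mem_of_mem_drop (h ▸ by simp : c ∈ w.drop i))
    rw [h0, add_zero]
    unfold goodWeight
    refine if_congr ?_ rfl rfl
    unfold IsGood
    refine and_congr_right fun _ => and_congr_right fun _ => and_congr_right fun _ => ?_
    refine forall₂_congr fun x hx => ?_
    have : x.val ≠ c.val := fun h => hcw (Fin.ext h ▸ hx)
    omega

end NUIO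

/-! ### Good words and the noncommutative power sums -/

section Euler

variable {R : Type*} [Ring R]

/-- The Euler derivation `t d/dt` on power series. -/
noncomputable def eulerD (f : PowerSeries R) : PowerSeries R :=
  PowerSeries.mk fun k => k * PowerSeries.coeff k f

theorem eulerD_sub (f g : PowerSeries R) : eulerD (f - g) = eulerD f - eulerD g := by
  ext k
  simp [eulerD, mul_sub]

theorem eulerD_X_mul_C_mul (a : R) (f : PowerSeries R) :
    eulerD (PowerSeries.X * (PowerSeries.C a * f)) =
      PowerSeries.X * (PowerSeries.C a * f) + PowerSeries.X * (PowerSeries.C a * eulerD f) := by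
  ext k
  cases k with
  | zero => simp [eulerD]
  | succ k =>
    simp only [eulerD, PowerSeries.coeff_mk, map_add, PowerSeries.coeff_succ_X_mul,
      PowerSeries.coeff_C_mul]
    rw [Nat.cast_succ, add_mul, one_mul, add_comm, ← mul_assoc, ← mul_assoc, (Nat.cast_commute k a).eq]

theorem eulerD_one : eulerD (1 : PowerSeries R) = 0 := by
  ext k
  cases k <;> simp [eulerD, PowerSeries.coeff_one]

end Euler

namespace NUIO

variable {n : ℕ} (P : NUIO n) {R : Type*} [Ring R] (u : Fin n → R)

theorem decSeries_succ (c : Fin n) :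
    wordSeries u (P.decWeight (c + 1)) = wordSeries u (P.decWeight c) -
      PowerSeries.X * (PowerSeries.C (u c) * wordSeries u (P.decWeight (P.below c))) := by
  classical
  rw [← wordSeries_cons u c (fun w => P.decWeight c w - P.decWeight (c + 1) w), wordSeries_sub,
    sub_sub_cancel]
  · have h : P.IsDecreasing [] := fun i h => by simp at h
    simp [decWeight, h]
  · exact P.decWeight_sub_cons c

theorem topSeries_mul (c : Fin n) :
    wordSeries u (P.topWeight c) * wordSeries u (P.decWeight c) =
      PowerSeries.X * (PowerSeries.C (u c) * wordSeries u (P.decWeight (P.below c))) := by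
  classical
  rw [wordSeries_mul]
  refine wordSeries_cons u c _ _ ?_ (P.splitMul_topWeight_decWeight c)
  simp [splitMul, topWeight]

theorem goodSeries_succ (c : Fin n) :
    wordSeries u (P.goodWeight (c + 1)) = wordSeries u (P.goodWeight c) +
      (1 + wordSeries u (P.goodWeight (c + 1)) - wordSeries u (P.goodWeight (P.below c))) *
        wordSeries u (P.topWeight c) := by
  conv_lhs => rw [show P.goodWeight (c + 1) = _ from funext (P.goodWeight_succ c)]
  rw [wordSeries_add, ← wordSeries_mul, wordSeries_sub, wordSeries_add, wordSeries_nil]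

/-- The series of words in letters below `c` commutes with `u c`. -/
theorem commute_goodSeries (hu : ∀ a c, P.lt a c → Commute (u a) (u c)) (c : Fin n) :
    Commute (wordSeries u (P.goodWeight (P.below c))) (PowerSeries.C (u c)) := by
  ext k
  rw [PowerSeries.coeff_mul_C, PowerSeries.coeff_C_mul, coeff_wordSeries, wordSum,
    Finset.sum_mul, Finset.mul_sum]
  refine Finset.sum_congr rfl fun w _ => ?_
  unfold goodWeight
  split_ifs with h
  · rw [one_smul]
    refine (Commute.list_prod_right _ _ fun x hx => ?_).eq.symm
    obtain ⟨a, ha, rfl⟩ := List.mem_map.1 hx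
    exact (hu a c (P.lt_iff_below.2 (h.2.2.2 a ha))).symm
  · simp

theorem goodSeries_mul_decSeries (hu : ∀ a c, P.lt a c → Commute (u a) (u c)) (j : ℕ)
    (hj : j ≤ n) :
    wordSeries u (P.goodWeight j) * wordSeries u (P.decWeight j) =
      - eulerD (wordSeries u (P.decWeight j)) := by
  induction j using Nat.strong_induction_on with
  | _ j ih =>
  cases j with
  | zero =>
    have h1 : P.goodWeight 0 = fun _ => 0 := by
      funext w
      refine if_neg fun h => ?_
      obtain ⟨a, ha⟩ := List.exists_mem_of_ne_nil _ h.1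
      exact absurd (h.2.2.2 a ha) (Nat.not_lt_zero _)
    have h2 : wordSeries u (P.decWeight 0) = (1 : PowerSeries R) := by
      rw [← wordSeries_nil u]
      congr 1
      funext w
      have h : P.IsDecreasing [] := fun i h => by simp at h
      cases w with
      | nil => simp [decWeight, h]
      | cons a w => exact if_neg fun h => absurd (h.2 a (by simp)) (Nat.not_lt_zero _)
    have h3 : wordSeries u (fun _ => (0 : ℤ)) = (0 : PowerSeries R) := by
      ext k
      simp [wordSum]
    rw [h1, h2, h3, eulerD_one, zero_mul, neg_zero]
  | succ j =>
    obtain ⟨c, rfl⟩ : ∃ c : Fin n, c.val = j := ⟨⟨j, hj⟩, rfl⟩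
    have hc := ih c (Nat.lt_succ_self _) c.2.le
    have hf := ih (P.below c) (Nat.lt_succ_of_le (P.below_le c)) ((P.below_le c).trans c.2.le)
    -- Right multiplication by D_c turns T_c into t u_c D_f and, by induction, G_c into -t D_c'. The
    -- terms containing G_{c+1} then combine to G_{c+1} D_{c+1}.
    have h1 := congrArg (· * wordSeries u (P.decWeight c)) (P.goodSeries_succ u c)
    simp only [add_mul, mul_assoc, topSeries_mul, hc] at h1
    -- Moving G_f past u_c makes the induction hypothesis for f applicable; this is where the
    -- commutation relations enter.
    have h2 : wordSeries u (P.goodWeight (P.below c)) *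
        (PowerSeries.X * (PowerSeries.C (u c) * wordSeries u (P.decWeight (P.below c)))) =
        - (PowerSeries.X * (PowerSeries.C (u c) *
          eulerD (wordSeries u (P.decWeight (P.below c))))) := by
      rw [← mul_assoc, (PowerSeries.commute_X _).eq, mul_assoc, ← mul_assoc _ (PowerSeries.C _),
        (P.commute_goodSeries u hu c).eq, mul_assoc, hf, mul_neg, mul_neg]
    rw [decSeries_succ, mul_sub, eulerD_sub, eulerD_X_mul_C_mul, h1, sub_mul, add_mul, h2]
    noncomm_ring

/-- The image of `e_k` under a homomorphism. -/
theorem map_ncE (π : FreeAlgebra ℤ (Fin n) →+* R) (k : ℕ) :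
    π (P.ncE k) = (-1) ^ k * wordSum (fun i => π (FreeAlgebra.ι ℤ i)) (P.decWeight n) k := by
  classical
  rw [ncE, map_sum, wordSum, Finset.mul_sum, Finset.sum_filter]
  refine Finset.sum_congr rfl fun w hw => ?_
  rw [mem_wordsOfLength] at hw
  have h : ∀ x ∈ w, x.val < n := fun x _ => x.2
  unfold decWeight
  rw [if_congr (and_iff_left h) rfl rfl, hw]
  split_ifs
  · rw [uWord, map_list_prod, List.map_map, zsmul_eq_mul, ← mul_assoc]
    push_cast
    rw [← pow_add, Even.neg_one_pow ⟨k, rfl⟩, one_mul]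
    rfl
  · simp

theorem sum_goodWords (π : FreeAlgebra ℤ (Fin n) →+* R) {k : ℕ} (hk : 1 ≤ k) :
    ∑ w ∈ P.goodWords k, π (uWord w) =
      wordSum (fun i => π (FreeAlgebra.ι ℤ i)) (P.goodWeight n) k := by
  classical
  rw [goodWords, wordSum, Finset.sum_filter]
  refine Finset.sum_congr rfl fun w hw => ?_
  rw [mem_wordsOfLength] at hw
  have h : P.IsGood n w ↔ P.NoDescents w ∧ P.NoNontrivialMaxima w := by
    have h1 : w ≠ [] := by
      rintro rfl
      simp at hw
      omega
    have h2 : ∀ x ∈ w, x.val < n := fun x _ => x.2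
    simp [IsGood, h1]
  unfold goodWeight
  rw [if_congr h rfl rfl, ite_smul, one_smul, zero_smul, uWord, map_list_prod, List.map_map]
  rfl

theorem ncE_zero : P.ncE 0 = 1 := by
  classical
  have h2 : P.IsDecreasing [] := fun i h => by simp at h
  simp [ncE, wordsOfLength_zero, Finset.filter_singleton, h2, uWord]

theorem decSeries_mul_ncH (π : FreeAlgebra ℤ (Fin n) →+* R) :
    wordSeries (fun i => π (FreeAlgebra.ι ℤ i)) (P.decWeight n) *
      PowerSeries.mk (fun k => π (P.ncH k)) = 1 := by
  ext k
  simp only [PowerSeries.coeff_mul, coeff_wordSeries, PowerSeries.coeff_mk, PowerSeries.coeff_one]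
  have h : ∀ i, wordSum (fun i => π (FreeAlgebra.ι ℤ i)) (P.decWeight n) i =
      (-1) ^ i * π (P.ncE i) := by
    intro i
    rw [map_ncE, ← mul_assoc, ← pow_add, Even.neg_one_pow ⟨i, rfl⟩, one_mul]
  simp only [h]
  rw [Finset.Nat.sum_antidiagonal_eq_sum_range_succ
    (fun i j => (-1) ^ i * π (P.ncE i) * π (P.ncH j))]
  cases k with
  | zero => simp [ncE_zero, ncH]
  | succ k =>
    have h1 := congrArg π (P.ncH_relation k)
    simpa [mul_assoc] using h1

/-- Modulo the commutation relations, the noncommutative power sums are sums of good words. -/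
theorem map_ncP (π : FreeAlgebra ℤ (Fin n) →+* R)
    (hu : ∀ a c, P.lt a c → Commute (π (FreeAlgebra.ι ℤ a)) (π (FreeAlgebra.ι ℤ c)))
    {k : ℕ} (hk : 1 ≤ k) : π (P.ncP k) = ∑ w ∈ P.goodWords k, π (uWord w) := by
  rw [sum_goodWords P π hk]
  have h1 := congrArg (· * PowerSeries.mk (fun k => π (P.ncH k)))
    (P.goodSeries_mul_decSeries _ hu n le_rfl)
  simp only [mul_assoc, decSeries_mul_ncH, mul_one] at h1
  rw [← coeff_wordSeries, h1, PowerSeries.coeff_mul, Finset.Nat.sum_antidiagonal_eq_sum_range_succ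
    (fun i j => PowerSeries.coeff i _ * PowerSeries.coeff j _), Finset.sum_range_succ', ncP]
  simp only [eulerD, PowerSeries.coeff_mk, map_neg, coeff_wordSeries]
  rw [Nat.cast_zero, zero_mul, neg_zero, zero_mul, add_zero, map_sum,
    ← Finset.Ico_add_one_right_eq_Icc, Finset.sum_Ico_eq_sum_range, Nat.add_sub_cancel]
  refine Finset.sum_congr rfl fun i _ => ?_
  rw [add_comm 1 i, Nat.add_sub_cancel]
  simp only [map_mul, map_pow, map_neg, map_one, map_natCast, map_ncE]
  rw [pow_succ]
  rcases neg_one_pow_eq_or R i with h | h <;> rw [h] <;> noncomm_ring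

end NUIO

/-! ### The noncommutative elementary functions commute -/

namespace NUIO

variable {n : ℕ} (P : NUIO n) {R : Type*} [Ring R] (u : Fin n → R)

/-- The noncommutative elementary function `e_k` in the first `j` letters. -/
noncomputable def elemSum (j k : ℕ) : R := (-1) ^ k * wordSum u (P.decWeight j) k

theorem elemSum_zero_right (j : ℕ) : P.elemSum u j 0 = 1 := by
  have h : P.IsDecreasing [] := fun i h => by simp at h
  simp [elemSum, wordSum_zero, decWeight, h]

theorem elemSum_zero_left (k : ℕ) : P.elemSum u 0 (k + 1) = 0 := by
  rw [elemSum, wordSum_eq_zero, mul_zero]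
  intro w hw
  refine if_neg fun h => ?_
  obtain ⟨a, ha⟩ := List.exists_mem_of_length_pos (hw ▸ Nat.succ_pos k : 0 < w.length)
  exact Nat.not_lt_zero _ (h.2 a ha)

theorem elemSum_succ (c : Fin n) (k : ℕ) :
    P.elemSum u (c + 1) (k + 1) = P.elemSum u c (k + 1) + u c * P.elemSum u (P.below c) k := by
  have h := congrArg (PowerSeries.coeff (k + 1)) (P.decSeries_succ u c)
  simp only [map_sub, PowerSeries.coeff_succ_X_mul, PowerSeries.coeff_C_mul,
    coeff_wordSeries] at h
  simp only [elemSum, h, pow_succ]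
  rcases neg_one_pow_eq_or R k with h | h <;> rw [h] <;> noncomm_ring

theorem commute_elemSum {x : R} {j : ℕ} (hx : ∀ a : Fin n, a.val < j → Commute x (u a)) (hj : j ≤ n)
    (k : ℕ) : Commute x (P.elemSum u j k) := by
  induction j using Nat.strong_induction_on generalizing k with
  | _ j ih =>
  cases k with
  | zero =>
    rw [elemSum_zero_right]
    exact Commute.one_right x
  | succ k =>
    cases j with
    | zero =>
      rw [elemSum_zero_left]
      exact Commute.zero_right x
    | succ j =>
      obtain ⟨c, rfl⟩ : ∃ c : Fin n, c.val = j := ⟨⟨j, hj⟩, rfl⟩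
      have hc := P.below_le c
      rw [elemSum_succ]
      refine (ih c (Nat.lt_succ_self _) (fun a ha => hx a (by omega)) (by omega) _).add_right
        ((hx c (Nat.lt_succ_self _)).mul_right ?_)
      exact ih _ (by omega) (fun a ha => hx a (by omega)) (by omega) _

variable (hC : ∀ a c, P.lt a c → Commute (u a) (u c))
  (hT : ∀ a b c, a < b → b < c → ¬ P.lt a b → ¬ P.lt b c → P.lt a c →
    u a * u c * u b = u b * u a * u c)

include hC

theorem commute_letter_elemSum (c : Fin n) {j : ℕ} (hj : j ≤ P.below c) (k : ℕ) :
    Commute (u c) (P.elemSum u j k) :=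
  P.commute_elemSum u (fun a ha => (hC a c (P.lt_iff_below.2 (ha.trans_le hj))).symm)
    (hj.trans ((P.below_le c).trans c.2.le)) k

include hT

/-- A letter a with `P.below b ≤ a < P.below c` is incomparable to b and P-below c, so u_a u_c u_b =
u_b u_a u_c = u_b u_c u_a: passing such a letter reverses u_c u_b. Letters below b commute with
both. A decreasing word starting with such an a continues in letters below a, hence reverses u_c u_b
exactly once. -/
theorem elemSum_mul_letters {b c : Fin n} (hbc : b < c) (hcb : P.below c ≤ b) (i : ℕ)
    (hbi : P.below b ≤ i) (hic : i ≤ P.below c) (k : ℕ) :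
    P.elemSum u i k * (u c * u b) = u c * u b * P.elemSum u (P.below b) k +
      u b * u c * (P.elemSum u i k - P.elemSum u (P.below b) k) := by
  induction i, hbi using Nat.le_induction generalizing k with
  | base =>
    rw [sub_self, mul_zero, add_zero]
    exact ((P.commute_letter_elemSum u hC c (P.below_mono hbc.le) k).mul_left
      (P.commute_letter_elemSum u hC b le_rfl k)).eq.symm
  | succ i hbi ih =>
    cases k with
    | zero => simp [elemSum_zero_right]
    | succ k =>
      obtain ⟨a, rfl⟩ : ∃ a : Fin n, a.val = i := ⟨⟨i, by omega⟩, rfl⟩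
      have hab : a < b := Fin.lt_def.2 (by omega)
      have h1 := hT a b c hab hbc (by rw [lt_iff_below]; omega) (by rw [lt_iff_below]; omega)
        (P.lt_iff_below.2 hic)
      have h2 : Commute (P.elemSum u (P.below a) k) (u c * u b) :=
        ((P.commute_letter_elemSum u hC c (P.below_mono (hab.trans hbc).le) k).mul_left
          (P.commute_letter_elemSum u hC b (P.below_mono hab.le) k)).symm
      have h3 : u a * P.elemSum u (P.below a) k * (u c * u b) =
          u b * u c * (u a * P.elemSum u (P.below a) k) := by
        rw [mul_assoc, h2.eq, ← mul_assoc, ← mul_assoc, h1, mul_assoc (u b),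
          (hC a c (P.lt_iff_below.2 hic)).eq]
        simp only [mul_assoc]
      rw [elemSum_succ, add_mul, ih (by omega), h3]
      noncomm_ring

/-- Commutativity alone does not pass through the recursion for a new letter, because brackets of
different truncations appear. For these it suffices that the bracket be symmetric in k and l, so
both statements are carried through one strong induction. -/
theorem elemSum_lie_symm (j : ℕ) (hj : j ≤ n) :
    (∀ k l, ⁅P.elemSum u j k, P.elemSum u j l⁆ = 0) ∧
    ∀ i ≤ j, (∀ c : Fin n, c.val < j → P.below c ≤ i) → ∀ k l,
      ⁅P.elemSum u i k, P.elemSum u j l⁆ = ⁅P.elemSum u i l, P.elemSum u j k⁆ := by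
  have hone : ∀ x : R, ⁅x, (1 : R)⁆ = 0 := fun x => by simp [Ring.lie_def]
  have hone' : ∀ x : R, ⁅(1 : R), x⁆ = 0 := fun x => by simp [Ring.lie_def]
  have hal : ∀ x y z : R, ⁅x + y, z⁆ = ⁅x, z⁆ + ⁅y, z⁆ := fun x y z => by
    simp only [Ring.lie_def]
    noncomm_ring
  have hla : ∀ x y z : R, ⁅x, y + z⁆ = ⁅x, y⁆ + ⁅x, z⁆ := fun x y z => by
    simp only [Ring.lie_def]
    noncomm_ring
  have hskew : ∀ x y : R, ⁅x, y⁆ = -⁅y, x⁆ := fun x y => by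
    simp only [Ring.lie_def, neg_sub]
  induction j using Nat.strong_induction_on with
  | _ j ih =>
  cases j with
  | zero =>
    have h : ∀ k l, ⁅P.elemSum u 0 k, P.elemSum u 0 l⁆ = 0 := by
      intro k l
      cases k <;> simp [elemSum_zero_left, elemSum_zero_right, Ring.lie_def]
    refine ⟨h, fun i hi _ k l => ?_⟩
    obtain rfl := Nat.le_zero.1 hi
    rw [h, h]
  | succ j =>
    obtain ⟨c, rfl⟩ : ∃ c : Fin n, c.val = j := ⟨⟨j, hj⟩, rfl⟩
    have hfc := P.below_le c
    have hcomm := fun j (hj : j ≤ c.val) => (ih j (by omega) (by omega)).1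
    -- By `elemSum_mul_letters` the bracket is u_b u_c times a bracket of smaller truncations, minus
    -- (u_c u_b - u_b u_c) times a product of two commuting elementary functions. Both are symmetric
    -- in k and l by induction.
    have hJ : ∀ b : Fin n, b < c → P.below c ≤ b → ∀ k l,
        ⁅u b * P.elemSum u (P.below b) k, u c * P.elemSum u (P.below c) l⁆ =
        ⁅u b * P.elemSum u (P.below b) l, u c * P.elemSum u (P.below c) k⁆ := by
      intro b hbc hcb
      have hbb := P.below_le b
      have hbc' := P.below_mono hbc.le
      have h1 : ∀ k l, ⁅u b * P.elemSum u (P.below b) k, u c * P.elemSum u (P.below c) l⁆ =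
          u b * u c * ⁅P.elemSum u (P.below b) k, P.elemSum u (P.below c) l⁆ -
          (u c * u b - u b * u c) * (P.elemSum u (P.below b) l * P.elemSum u (P.below b) k) := by
        intro k l
        have h2 : u c * P.elemSum u (P.below c) l * (u b * P.elemSum u (P.below b) k) =
            P.elemSum u (P.below c) l * (u c * u b) * P.elemSum u (P.below b) k := by
          rw [(P.commute_letter_elemSum u hC c le_rfl l).eq]
          simp only [mul_assoc]
        have h3 : u b * P.elemSum u (P.below b) k * (u c * P.elemSum u (P.below c) l) =
            u b * u c * (P.elemSum u (P.below b) k * P.elemSum u (P.below c) l) := by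
          rw [mul_assoc, ← mul_assoc _ (u c), ← (P.commute_letter_elemSum u hC c hbc' k).eq]
          simp only [mul_assoc]
        rw [Ring.lie_def, Ring.lie_def, h2, h3,
          P.elemSum_mul_letters u hC hT hbc hcb _ hbc' le_rfl l]
        noncomm_ring
      intro k l
      have h4 := hcomm (P.below b) (by omega) k l
      rw [Ring.lie_def, sub_eq_zero] at h4
      rw [h1, h1, h4, (ih (P.below c) (by omega) (by omega)).2 (P.below b) hbc'
        (fun a ha => P.below_mono (Fin.le_def.2 (by omega))) k l]
    -- Starting from the letters below c, where both brackets vanish, each further letter b is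
    -- incomparable to c and adds a difference controlled by `hJ`.
    have hD : ∀ i, P.below c ≤ i → i ≤ c → ∀ k l,
        ⁅P.elemSum u i (k + 1), u c * P.elemSum u (P.below c) l⁆ =
        ⁅P.elemSum u i (l + 1), u c * P.elemSum u (P.below c) k⁆ := by
      intro i hi
      induction i, hi using Nat.le_induction with
      | base =>
        intro _
        have h1 : ∀ k l, ⁅P.elemSum u (P.below c) k, u c * P.elemSum u (P.below c) l⁆ = 0 := by
          intro k l
          have h2 := hcomm (P.below c) hfc k l
          rw [Ring.lie_def, sub_eq_zero] at h2
          rw [Ring.lie_def, ← mul_assoc, ← (P.commute_letter_elemSum u hC c le_rfl k).eq,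
            mul_assoc, h2, mul_assoc, sub_self]
        intro k l
        rw [h1, h1]
      | succ i hi ih' =>
        intro hic k l
        obtain ⟨b, rfl⟩ : ∃ b : Fin n, b.val = i := ⟨⟨i, by omega⟩, rfl⟩
        rw [elemSum_succ, elemSum_succ, hal, hal, ih' (by omega) k l,
          hJ b (Fin.lt_def.2 hic) hi k l]
    -- Of the four brackets obtained by splitting off c, the two pure ones vanish and the two mixed
    -- ones cancel by `hD` and antisymmetry.
    have hfirst : ∀ k l, ⁅P.elemSum u (c + 1) k, P.elemSum u (c + 1) l⁆ = 0 := by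
      intro k l
      cases k with
      | zero => rw [elemSum_zero_right, hone']
      | succ k =>
        cases l with
        | zero => rw [elemSum_zero_right, hone]
        | succ l =>
          have h1 : ⁅u c * P.elemSum u (P.below c) k, u c * P.elemSum u (P.below c) l⁆ = 0 := by
            have h2 := hcomm (P.below c) hfc k l
            rw [Ring.lie_def, sub_eq_zero] at h2
            have h3 : ∀ k l, u c * P.elemSum u (P.below c) k * (u c * P.elemSum u (P.below c) l) =
                u c * u c * (P.elemSum u (P.below c) k * P.elemSum u (P.below c) l) := by
              intro k l
              rw [mul_assoc, ← mul_assoc _ (u c), ← (P.commute_letter_elemSum u hC c le_rfl k).eq]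
              simp only [mul_assoc]
            rw [Ring.lie_def, h3, h3, h2, sub_self]
          rw [elemSum_succ, elemSum_succ, hal, hla, hla, hcomm c le_rfl, h1,
            hD c hfc le_rfl k l, hskew (P.elemSum u c (l + 1)), zero_add, add_zero,
            neg_add_cancel]
    refine ⟨hfirst, fun i hi hci k l => ?_⟩
    rcases Nat.lt_or_ge c i with h | h
    · obtain rfl : i = c + 1 := by omega
      rw [hfirst, hfirst]
    · cases k with
      | zero => rw [elemSum_zero_right, elemSum_zero_right, hone', hone]
      | succ k =>
        cases l with
        | zero => rw [elemSum_zero_right, elemSum_zero_right, hone', hone]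
        | succ l =>
          rw [elemSum_succ, elemSum_succ, hla, hla,
            hD i (hci c (Nat.lt_succ_self _)) h k l,
            (ih c (Nat.lt_succ_self _) c.2.le).2 i h (fun a ha => hci a (by omega)) (k + 1) (l + 1)]

theorem commute_elemSum_elemSum (k l : ℕ) : Commute (P.elemSum u n k) (P.elemSum u n l) := by
  have h := (P.elemSum_lie_symm u hC hT n le_rfl).1 k l
  rwa [Ring.lie_def, sub_eq_zero] at h

end NUIO

/-! ### Newton's identities -/

section Newton

/-- Newton's identities between elementary functions `e` and power sums `p`. -/
def IsNewton {A : Type*} [Ring A] (e p : ℕ → A) : Prop :=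
  ∀ k : ℕ, (k : A) * e k = ∑ i ∈ Finset.range k, (-1) ^ i * (p (i + 1) * e (k - (i + 1)))

theorem IsNewton.map {A B : Type*} [Ring A] [Ring B] {e p : ℕ → A} (h : IsNewton e p)
    (f : A →+* B) : IsNewton (fun k => f (e k)) (fun k => f (p k)) := by
  intro k
  have h1 := congrArg f (h k)
  simpa using h1

theorem IsNewton.unique {A : Type*} [Ring A] {e p p' : ℕ → A} (h : IsNewton e p)
    (h' : IsNewton e p') (h0 : e 0 = 1) (k : ℕ) : p (k + 1) = p' (k + 1) := by
  induction k using Nat.strong_induction_on with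
  | _ k ih =>
  have h1 := (h (k + 1)).symm.trans (h' (k + 1))
  rw [Finset.sum_range_succ, Finset.sum_range_succ, Finset.sum_congr rfl fun i hi => by
    rw [ih i (Finset.mem_range.1 hi)]] at h1
  have h2 := add_left_cancel h1
  rw [Nat.sub_self, h0, mul_one, mul_one] at h2
  rcases neg_one_pow_eq_or A k with h | h <;> rw [h] at h2 <;> simpa using h2

/-- The power sums determined by elementary functions through Newton's identities. -/
def newtonSum {A : Type*} [Ring A] (e : ℕ → A) : ℕ → A
  | 0 => 0
  | k + 1 => (-1) ^ k * (((k + 1 : ℕ) : A) * e (k + 1) -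
      ∑ i : Fin k, (-1) ^ (i : ℕ) * (newtonSum e (i + 1) * e (k - i)))

theorem isNewton_newtonSum {A : Type*} [Ring A] (e : ℕ → A) (h0 : e 0 = 1) :
    IsNewton e (newtonSum e) := by
  intro k
  cases k with
  | zero => simp
  | succ k =>
    rw [Finset.sum_range_succ, Nat.sub_self, h0, mul_one]
    conv_rhs => rw [newtonSum]
    rw [← mul_assoc, ← pow_add, Even.neg_one_pow ⟨k, rfl⟩, one_mul,
      Fin.sum_univ_eq_sum_range (fun i => (-1) ^ i * (newtonSum e (i + 1) * e (k - i)))]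
    simp

end Newton

/-! ### Newton's identities for symmetric series -/

section SymmetricSeries

variable {S : Type*} [CommRing S]

theorem coeff_symP_mul {k : ℕ} (hk : 0 < k) (f : MvPowerSeries ℕ S) (m : ℕ →₀ ℕ) :
    MvPowerSeries.coeff m (symP S k * f) =
      ∑ j ∈ m.support with k ≤ m j, MvPowerSeries.coeff (m - Finsupp.single j k) f := by
  classical
  rw [MvPowerSeries.coeff_mul]
  have hP : ∀ a : ℕ →₀ ℕ, MvPowerSeries.coeff a (symP S k) =
    if ∃ i, a = Finsupp.single i k then 1 else 0 := fun a => rfl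
  symm
  refine Finset.sum_of_injOn (fun j => (Finsupp.single j k, m - Finsupp.single j k)) ?_ ?_ ?_ ?_
  · intro i _ j _ h
    have h1 := (Prod.ext_iff.1 h).1
    exact (Finsupp.single_left_inj hk.ne').1 h1
  · intro j hj
    rw [Finset.mem_coe, Finset.mem_filter] at hj
    rw [Finset.mem_coe, Finset.HasAntidiagonal.mem_antidiagonal]
    exact add_tsub_cancel_of_le (Finsupp.single_le_iff.2 hj.2)
  · rintro ⟨a, b⟩ hab hn
    rw [Finset.HasAntidiagonal.mem_antidiagonal] at hab
    rw [hP, if_neg, zero_mul]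
    rintro ⟨j, hj⟩
    simp only at hj hab
    subst hj
    apply hn
    have h1 : k ≤ m j := by
      rw [← hab]
      simp
    refine ⟨j, by simp [h1]; omega, ?_⟩
    rw [← hab]
    simp
  · intro j _
    rw [hP, if_pos ⟨j, rfl⟩, one_mul]

variable {A : Type*} [CommRing A] (e p : ℕ → A) (Ψ : A →+ S)

/-- The series `∑ Ψ(y e_{m_0} e_{m_1} ⋯) x^m` over the exponents `m` of degree `d`. -/
noncomputable def elemSeries (d : ℕ) (y : A) : MvPowerSeries ℕ S :=
  fun m => if m.degree = d then Ψ (y * m.prod fun _ k => e k) else 0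

theorem coeff_elemSeries (d : ℕ) (y : A) (m : ℕ →₀ ℕ) :
    MvPowerSeries.coeff m (elemSeries e Ψ d y) =
      if m.degree = d then Ψ (y * m.prod fun _ k => e k) else 0 := rfl

theorem degree_tsub_single {m : ℕ →₀ ℕ} {j k : ℕ} (h : k ≤ m j) :
    (m - Finsupp.single j k).degree + k = m.degree := by
  conv_rhs => rw [← tsub_add_cancel_of_le (Finsupp.single_le_iff.2 h)]
  simp

theorem prod_tsub_single (h0 : e 0 = 1) (m : ℕ →₀ ℕ) (j k : ℕ) :
    ((m - Finsupp.single j k).prod fun _ k => e k) =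
      e (m j - k) * (m.erase j).prod fun _ k => e k := by
  rw [← Finsupp.mul_prod_erase' _ j (fun _ k => e k) fun _ => h0]
  congr 1
  · simp
  · congr 1
    ext i
    by_cases hi : i = j
    · simp [hi]
    · simp [hi, Finsupp.single_eq_of_ne hi]

/-- Euler's trick: write d as the sum of the exponents m_j and apply Newton's identity to each m_j
e_{m_j}. In the term with p_{i+1}, that factor joins y, while x_j^{i+1} splits off from x^m and sums
over j to a power sum. -/
theorem elemSeries_rec (h0 : e 0 = 1) (hN : IsNewton e p) (d : ℕ) (y : A) :
    (d : MvPowerSeries ℕ S) * elemSeries e Ψ d y =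
      ∑ i ∈ Finset.range d, (-1) ^ i * (symP S (i + 1) *
        elemSeries e Ψ (d - (i + 1)) (y * p (i + 1))) := by
  ext m
  have hsign : ∀ (i : ℕ) (f : MvPowerSeries ℕ S),
      MvPowerSeries.coeff m ((-1) ^ i * f) = (-1) ^ i * MvPowerSeries.coeff m f := by
    intro i f
    rcases Nat.even_or_odd i with h | h <;> simp [h.neg_one_pow]
  rw [← nsmul_eq_mul, map_nsmul, coeff_elemSeries, map_sum]
  simp only [hsign, coeff_symP_mul (Nat.succ_pos _), coeff_elemSeries]
  by_cases hm : m.degree = d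
  · rw [if_pos hm]
    have h1 : ∀ i ∈ Finset.range d, ∀ j ∈ m.support.filter fun j => i + 1 ≤ m j,
        (if (m - Finsupp.single j (i + 1)).degree = d - (i + 1) then
          Ψ (y * p (i + 1) * (m - Finsupp.single j (i + 1)).prod fun _ k => e k) else 0) =
        Ψ (y * p (i + 1) * (e (m j - (i + 1)) * (m.erase j).prod fun _ k => e k)) := by
      intro i _ j hj
      have h2 := degree_tsub_single (Finset.mem_filter.1 hj).2
      rw [if_pos (by omega), prod_tsub_single e h0]
    rw [Finset.sum_congr rfl fun i hi => by rw [Finset.sum_congr rfl (h1 i hi)]]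
    simp only [Finset.mul_sum, Finset.sum_filter]
    rw [Finset.sum_comm]
    conv_lhs => rw [← hm, Finsupp.degree_apply, Finset.sum_smul]
    refine Finset.sum_congr rfl fun j hj => ?_
    rw [← map_nsmul, ← Finsupp.mul_prod_erase' m j (fun _ k => e k) fun _ => h0, nsmul_eq_mul,
      show (m j : A) * (y * (e (m j) * (m.erase j).prod fun _ k => e k)) =
        y * (m.erase j).prod (fun _ k => e k) * ((m j : A) * e (m j)) by ring, hN (m j),
      Finset.mul_sum, map_sum]
    have hjd : m j ≤ d := hm ▸ Finsupp.le_degree j m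
    simp only [mul_ite, mul_zero]
    rw [← Finset.sum_filter]
    -- As m_j ≤ d, restricting to powers of x_j that divide x^m leaves exactly the range of Newton's
    -- identity for m_j.
    have h3 : (Finset.range d).filter (fun i => i + 1 ≤ m j) = Finset.range (m j) := by
      ext i
      simp
      omega
    rw [h3]
    refine Finset.sum_congr rfl fun i _ => ?_
    rcases Nat.even_or_odd i with h | h
    · rw [h.neg_one_pow, h.neg_one_pow, one_mul, one_mul]
      congr 1
      ring
    · rw [h.neg_one_pow, h.neg_one_pow, neg_one_mul, neg_one_mul, ← map_neg]
      congr 1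
      ring
  · rw [if_neg hm, smul_zero]
    symm
    refine Finset.sum_eq_zero fun i hi => ?_
    rw [Finset.sum_eq_zero, mul_zero]
    intro j hj
    have h2 := degree_tsub_single (Finset.mem_filter.1 hj).2
    have h3 := Finset.mem_range.1 hi
    exact if_neg (by omega)

-- The case of `elemSeries_rec` for the numbers 1, 1, 0, 0, …, the elementary functions of one
-- variable equal to 1, whose power sums are all 1.
open Classical in
theorem isNewton_symE : IsNewton (symE S) (symP S) := by
  intro d
  have h1 := elemSeries_rec (fun k => if k ≤ 1 then (1 : ℤ) else 0) (fun _ => 1)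
    (Int.castAddHom S) (by simp) ?_ d 1
  · have h2 : ∀ d, elemSeries (fun k => if k ≤ 1 then (1 : ℤ) else 0) (Int.castAddHom S) d 1 =
        symE S d := by
      intro d
      ext m
      rw [coeff_elemSeries, one_mul]
      have h6 : MvPowerSeries.coeff m (symE S d) =
          if m.degree = d ∧ ∀ i, m i ≤ 1 then 1 else 0 := rfl
      rw [h6]
      rw [Finsupp.prod, Finset.prod_ite_zero]
      have h3 : (∀ i ∈ m.support, m i ≤ 1) ↔ ∀ i, m i ≤ 1 := by
        refine ⟨fun h i => ?_, fun h i _ => h i⟩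
        by_cases hi : i ∈ m.support
        · exact h i hi
        · simp [Finsupp.notMem_support_iff.1 hi]
      rw [if_congr h3 rfl rfl]
      by_cases h4 : m.degree = d <;> by_cases h5 : ∀ i, m i ≤ 1 <;> simp [h4, h5]
    simpa only [mul_one, h2] using h1
  · intro k
    cases k with
    | zero => simp
    | succ k =>
      cases k with
      | zero => simp
      | succ k =>
        rw [Finset.sum_range_succ, Finset.sum_range_succ, Finset.sum_eq_zero]
        · simp [pow_succ]
        · intro i hi
          have := Finset.mem_range.1 hi
          have h1 : ¬ k + 1 + 1 - (i + 1) ≤ 1 := by omega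
          simp only [h1, if_false, mul_zero]

/-- The case of `elemSeries_rec` in which every e_k is 1, that is, ∑ e_k t^k = 1/(1 - t); the
corresponding power sums are the signs. -/
theorem isNewton_symH : IsNewton (symH S) (fun k => (-1) ^ (k - 1) * symP S k) := by
  intro d
  have h1 := elemSeries_rec (fun _ => (1 : ℤ)) (fun k => (-1) ^ (k - 1)) (Int.castAddHom S) rfl ?_
    d 1
  · have h2 : ∀ i d, elemSeries (fun _ => (1 : ℤ)) (Int.castAddHom S) d ((-1) ^ i) =
        (-1) ^ i * symH S d := by
      intro i d
      ext m
      have h3 : MvPowerSeries.coeff m (symH S d) = if m.degree = d then 1 else 0 := rfl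
      rw [coeff_elemSeries]
      by_cases h4 : m.degree = d <;> rcases Nat.even_or_odd i with h | h <;>
        simp [h.neg_one_pow, h3, h4, Finsupp.prod]
    have h4 := h2 0 d
    rw [pow_zero, pow_zero, one_mul] at h4
    rw [h4] at h1
    rw [h1]
    refine Finset.sum_congr rfl fun i _ => ?_
    simp only [one_mul, Nat.add_sub_cancel, h2]
    ring
  · intro k
    simp only [Nat.add_sub_cancel, mul_one, ← pow_add, fun i => Even.neg_one_pow (α := ℤ) (n := i + i) ⟨i, rfl⟩]
    simp

end SymmetricSeries

/-! ### The Cauchy expansion -/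

section Partitions

/-- The multisets of parts of the partitions of `d`. -/
def partMultisets (d : ℕ) : Finset (Multiset ℕ) :=
  (Finset.univ : Finset d.Partition).image Nat.Partition.parts

theorem mem_partMultisets {d : ℕ} {s : Multiset ℕ} :
    s ∈ partMultisets d ↔ s.sum = d ∧ ∀ x ∈ s, 0 < x := by
  simp only [partMultisets, Finset.mem_image, Finset.mem_univ, true_and]
  constructor
  · rintro ⟨l, rfl⟩
    exact ⟨l.parts_sum, fun x hx => l.parts_pos hx⟩
  · rintro ⟨rfl, h⟩
    exact ⟨⟨s, fun {x} hx => h x hx, rfl⟩, rfl⟩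

theorem sum_partMultisets {M : Type*} [AddCommMonoid M] {d : ℕ} (f : Multiset ℕ → M) :
    ∑ s ∈ partMultisets d, f s = ∑ l : d.Partition, f l.parts :=
  Finset.sum_image fun _ _ _ _ h => Nat.Partition.ext h

/-- `z_λ` for a multiset of parts. -/
def zMultiset (s : Multiset ℕ) : ℕ :=
  ∏ i ∈ s.toFinset, i ^ s.count i * (s.count i).factorial

theorem zMultiset_cons (k : ℕ) (s : Multiset ℕ) :
    zMultiset (k ::ₘ s) = k * (s.count k + 1) * zMultiset s := by
  have h1 : zMultiset s = ∏ i ∈ insert k s.toFinset, i ^ s.count i * (s.count i).factorial := by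
    refine Finset.prod_subset (Finset.subset_insert _ _) fun i _ hi => ?_
    rw [Multiset.mem_toFinset] at hi
    simp [Multiset.count_eq_zero_of_notMem hi]
  rw [h1, zMultiset, Multiset.toFinset_cons,
    ← Finset.mul_prod_erase _ _ (Finset.mem_insert_self k _),
    ← Finset.mul_prod_erase _ _ (Finset.mem_insert_self k _), ← mul_assoc]
  congr 1
  · rw [Multiset.count_cons_self, pow_succ, Nat.factorial_succ]
    ring
  · refine Finset.prod_congr rfl fun i hi => ?_
    rw [Multiset.count_cons_of_ne (Finset.ne_of_mem_erase hi)]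

theorem zMultiset_pos {s : Multiset ℕ} (h : ∀ x ∈ s, 0 < x) : 0 < zMultiset s :=
  Finset.prod_pos fun i hi =>
    Nat.mul_pos (pow_pos (h i (Multiset.mem_toFinset.1 hi)) _) (Nat.factorial_pos _)

/-- Write d as the sum of k times the multiplicity of k over the distinct parts k, and remove one
part k. By `zMultiset_cons` this factor is exactly the quotient of the two z's. -/
theorem sum_partMultisets_rec {M : Type*} [AddCommGroup M] [Module ℚ M] (d : ℕ)
    (f : Multiset ℕ → M) :
    (d : ℚ) • ∑ s ∈ partMultisets d, (zMultiset s : ℚ)⁻¹ • f s =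
      ∑ i ∈ Finset.range d, ∑ t ∈ partMultisets (d - (i + 1)),
        (zMultiset t : ℚ)⁻¹ • f ((i + 1) ::ₘ t) := by
  have h1 : ∀ s ∈ partMultisets d, (d : ℚ) • (zMultiset s : ℚ)⁻¹ • f s =
      ∑ k ∈ s.toFinset, ((s.count k * k : ℕ) : ℚ) • (zMultiset s : ℚ)⁻¹ • f s := by
    intro s hs
    rw [← Finset.sum_smul, ← (mem_partMultisets.1 hs).1, Finset.sum_multiset_count]
    simp
  rw [Finset.smul_sum, Finset.sum_congr rfl h1, Finset.sum_sigma', Finset.sum_sigma']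
  symm
  refine Finset.sum_bij' (fun x _ => ⟨(x.1 + 1) ::ₘ x.2, x.1 + 1⟩)
    (fun x _ => ⟨x.2 - 1, x.1.erase x.2⟩) ?_ ?_ ?_ ?_ ?_
  · rintro ⟨i, t⟩ h
    simp only [Finset.mem_sigma, Finset.mem_range, mem_partMultisets, Multiset.sum_cons,
      Multiset.mem_cons, Multiset.mem_toFinset] at h ⊢
    refine ⟨⟨by omega, ?_⟩, Or.inl trivial⟩
    rintro x (rfl | hx)
    · exact Nat.succ_pos _
    · exact h.2.2 x hx
  · rintro ⟨s, k⟩ h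
    simp only [Finset.mem_sigma, Finset.mem_range, mem_partMultisets, Multiset.mem_toFinset] at h ⊢
    have h2 := Multiset.sum_erase h.2
    have h3 := h.1.2 k h.2
    exact ⟨by omega, by omega, fun x hx => h.1.2 x (Multiset.mem_of_mem_erase hx)⟩
  · rintro ⟨i, t⟩ h
    simp
  · rintro ⟨s, k⟩ h
    simp only [Finset.mem_sigma, mem_partMultisets, Multiset.mem_toFinset] at h
    have h3 := h.1.2 k h.2
    have h4 : k - 1 + 1 = k := by omega
    simp only [h4, Multiset.cons_erase h.2]
  · rintro ⟨i, t⟩ h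
    simp only [Finset.mem_sigma, Finset.mem_range, mem_partMultisets] at h
    simp only [zMultiset_cons, smul_smul, Multiset.count_cons_self]
    congr 1
    have h5 : (zMultiset t : ℚ) ≠ 0 := by
      exact_mod_cast (zMultiset_pos h.2.2).ne'
    push_cast
    field_simp

end Partitions

section Cauchy

variable {S : Type*} [CommRing S]

/-- The sign `(-1) ^ (|λ| - ℓ(λ))`. -/
def partSign (S : Type*) [CommRing S] (s : Multiset ℕ) : S :=
  (s.map fun k => (-1 : S) ^ (k - 1)).prod

theorem partSign_mul_self (s : Multiset ℕ) : partSign S s * partSign S s = 1 := by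
  rw [partSign, ← Multiset.prod_map_mul]
  simp [← pow_add, fun i => Even.neg_one_pow (α := S) (n := i + i) ⟨i, rfl⟩]

variable [Algebra ℚ S] {A : Type*} [CommRing A] (e p : ℕ → A) (Ψ : A →+ S)

/-- The dual Cauchy identity under an additive map. Both sides satisfy the recursion of
`elemSeries_rec`, and d > 0 is invertible. The factor y is needed because the recursion multiplies
it by power sums and Ψ is not multiplicative. -/
theorem elemSeries_eq_sum (h0 : e 0 = 1) (hN : IsNewton e p) (d : ℕ) (y : A) :
    elemSeries e Ψ d y = ∑ s ∈ partMultisets d, (zMultiset s : ℚ)⁻¹ •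
      ((partSign S s * Ψ (y * (s.map p).prod)) • (s.map (symP S)).prod) := by
  induction d using Nat.strong_induction_on generalizing y with
  | _ d ih =>
  rcases Nat.eq_zero_or_pos d with rfl | hd
  · have h1 : partMultisets 0 = {0} := by
      ext s
      rw [mem_partMultisets, Finset.mem_singleton]
      constructor
      · rintro ⟨h1, h2⟩
        refine Multiset.eq_zero_of_forall_notMem fun x hx => ?_
        have h3 := Multiset.sum_eq_zero_iff.1 h1 x hx
        have h4 := h2 x hx
        omega
      · rintro rfl
        simp
    rw [h1, Finset.sum_singleton]
    ext m
    rw [coeff_elemSeries]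
    by_cases hm : m = 0
    · subst hm
      simp [zMultiset, partSign]
    · rw [if_neg (mt (Finsupp.degree_eq_zero_iff m).1 hm)]
      simp [zMultiset, partSign, MvPowerSeries.coeff_one, hm]
  · have h1 : (d : ℚ) • elemSeries e Ψ d y = (d : ℚ) • ∑ s ∈ partMultisets d,
        (zMultiset s : ℚ)⁻¹ •
          ((partSign S s * Ψ (y * (s.map p).prod)) • (s.map (symP S)).prod) := by
      rw [sum_partMultisets_rec, Nat.cast_smul_eq_nsmul, nsmul_eq_mul, elemSeries_rec e p Ψ h0 hN]
      refine Finset.sum_congr rfl fun i hi => ?_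
      rw [ih _ (by omega), Finset.mul_sum, Finset.mul_sum]
      refine Finset.sum_congr rfl fun t _ => ?_
      rw [Multiset.map_cons, Multiset.map_cons, Multiset.prod_cons, Multiset.prod_cons,
        show partSign S ((i + 1) ::ₘ t) = (-1) ^ i * partSign S t by simp [partSign], mul_smul_comm,
        mul_smul_comm, mul_smul_comm, mul_assoc y]
      congr 1
      rcases Nat.even_or_odd i with h | h <;> simp [h.neg_one_pow]
    have h2 : (d : ℚ) ≠ 0 := by exact_mod_cast hd.ne'
    have h3 := congrArg (fun x => (d : ℚ)⁻¹ • x) h1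
    simpa only [smul_smul, inv_mul_cancel₀ h2, one_smul] using h3

end Cauchy

/-! ### The effect of ω on power sums, and their independence -/

section Omega

variable (S : Type*) [CommRing S]

/-- The generic elementary functions: `1, X_0, X_1, …`. -/
noncomputable def genericE : ℕ → MvPolynomial ℕ S
  | 0 => 1
  | k + 1 => MvPolynomial.X k

theorem symE_zero : symE S 0 = 1 := by
  classical
  ext m
  have h : MvPowerSeries.coeff m (symE S 0) = if m.degree = 0 ∧ ∀ i, m i ≤ 1 then 1 else 0 := rfl
  rw [h, MvPowerSeries.coeff_one]
  refine if_congr ⟨fun h => (Finsupp.degree_eq_zero_iff m).1 h.1, ?_⟩ rfl rfl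
  rintro rfl
  simp

theorem symH_zero : symH S 0 = 1 := by
  classical
  ext m
  have h : MvPowerSeries.coeff m (symH S 0) = if m.degree = 0 then 1 else 0 := rfl
  rw [h, MvPowerSeries.coeff_one]
  exact if_congr (Finsupp.degree_eq_zero_iff m) rfl rfl

theorem aeval_genericE {B : Type*} [CommRing B] [Algebra S B] (e : ℕ → B) (h0 : e 0 = 1) (k : ℕ) :
    MvPolynomial.aeval (fun k => e (k + 1)) (genericE S k) = e k := by
  cases k <;> simp [genericE, h0]

/-- A family satisfying Newton's identities is the image of the generic power sums. -/
theorem aeval_newtonSum {B : Type*} [CommRing B] [Algebra S B] {e p : ℕ → B} (h0 : e 0 = 1)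
    (h : IsNewton e p) {k : ℕ} (hk : 0 < k) :
    MvPolynomial.aeval (fun k => e (k + 1)) (newtonSum (genericE S) k) = p k := by
  obtain ⟨k, rfl⟩ : ∃ j, k = j + 1 := ⟨k - 1, by omega⟩
  have h1 := (isNewton_newtonSum (genericE S) rfl).map
    (MvPolynomial.aeval (R := S) fun k => e (k + 1)).toRingHom
  have h2 : ∀ k, (MvPolynomial.aeval (R := S) fun k => e (k + 1)).toRingHom (genericE S k) = e k :=
    aeval_genericE S e h0
  simp only [h2] at h1
  exact h1.unique h h0 k

theorem aeval_symE_prod {s : Multiset ℕ} (hs : ∀ x ∈ s, 0 < x) :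
    MvPolynomial.aeval (fun k => symE S (k + 1)) (s.map (newtonSum (genericE S))).prod =
      (s.map (symP S)).prod := by
  rw [map_multiset_prod, Multiset.map_map]
  congr 1
  exact Multiset.map_congr rfl fun x hx => aeval_newtonSum S (symE_zero S) isNewton_symE (hs x hx)

theorem aeval_symH_prod {s : Multiset ℕ} (hs : ∀ x ∈ s, 0 < x) :
    MvPolynomial.aeval (fun k => symH S (k + 1)) (s.map (newtonSum (genericE S))).prod =
      partSign S s • (s.map (symP S)).prod := by
  have h1 : (s.map fun k => (-1) ^ (k - 1) * symP S k).prod =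
      partSign S s • (s.map (symP S)).prod := by
    rw [Multiset.prod_map_mul, Algebra.smul_def, partSign, map_multiset_prod, Multiset.map_map]
    simp
  rw [← h1, map_multiset_prod, Multiset.map_map]
  congr 1
  exact Multiset.map_congr rfl fun x hx => aeval_newtonSum S (symH_zero S) isNewton_symH (hs x hx)

/-- The generic power sum, a polynomial in the e's, becomes p_k at the e_k and (-1)^(k-1) p_k at the
h_k, because both families satisfy Newton's identities. -/
theorem omega_sum (T : Finset (Multiset ℕ)) (hT : ∀ s ∈ T, ∀ x ∈ s, 0 < x) (c : Multiset ℕ → S) :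
    omega S (∑ s ∈ T, c s • (s.map (symP S)).prod) =
      ∑ s ∈ T, (c s * partSign S s) • (s.map (symP S)).prod := by
  have h1 : ∑ s ∈ T, c s • (s.map (symP S)).prod =
      MvPolynomial.aeval (fun k => symE S (k + 1))
        (∑ s ∈ T, c s • (s.map (newtonSum (genericE S))).prod) := by
    rw [map_sum]
    refine Finset.sum_congr rfl fun s hs => ?_
    rw [map_smul, aeval_symE_prod S (hT s hs)]
  rw [h1, omega_aeval, map_sum]
  refine Finset.sum_congr rfl fun s hs => ?_
  rw [map_smul, aeval_symH_prod S (hT s hs), smul_smul]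

variable [Algebra ℚ S]

/-- The elementary functions in terms of the generic power sums `X_0, X_1, …`. -/
noncomputable def elemOfPower : ℕ → MvPolynomial ℕ S
  | 0 => 1
  | k + 1 => ((k + 1 : ℕ) : ℚ)⁻¹ • ∑ i : Fin (k + 1),
      (-1) ^ (i : ℕ) * (MvPolynomial.X (i : ℕ) * elemOfPower (k - i))
decreasing_by omega

theorem isNewton_elemOfPower :
    IsNewton (elemOfPower S) (fun k => MvPolynomial.X (k - 1)) := by
  intro k
  cases k with
  | zero => simp
  | succ k =>
    rw [elemOfPower, ← nsmul_eq_mul, ← Nat.cast_smul_eq_nsmul ℚ, smul_smul,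
      mul_inv_cancel₀ (by exact_mod_cast Nat.succ_ne_zero k), one_smul,
      ← Fin.sum_univ_eq_sum_range]
    refine Finset.sum_congr rfl fun i _ => ?_
    simp only [Nat.add_sub_cancel, Nat.add_sub_add_right]

/-- Over ℚ Newton's identities can be solved for the elementary functions, so the substitution θ of
generic power sums for the variables has a left inverse. Independence then follows from that of the
e_k. -/
theorem algebraicIndependent_symP :
    AlgebraicIndependent S (fun k => symP S (k + 1)) := by
  let θ : MvPolynomial ℕ S →ₐ[S] MvPolynomial ℕ S :=
    MvPolynomial.aeval fun k => newtonSum (genericE S) (k + 1)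
  have h1 : Function.LeftInverse (MvPolynomial.aeval fun k => elemOfPower S (k + 1)) θ := by
    intro x
    have h2 : (MvPolynomial.aeval fun k => elemOfPower S (k + 1)).comp θ =
        AlgHom.id S (MvPolynomial ℕ S) := by
      ext1 k
      rw [AlgHom.comp_apply, MvPolynomial.aeval_X, aeval_newtonSum S (by rw [elemOfPower])
        (isNewton_elemOfPower S) (Nat.succ_pos k)]
      rfl
    exact DFunLike.congr_fun h2 x
  have h3 : MvPolynomial.aeval (fun k => symP S (k + 1)) =
      (MvPolynomial.aeval fun k => symE S (k + 1)).comp θ := by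
    ext1 k
    rw [AlgHom.comp_apply, MvPolynomial.aeval_X, MvPolynomial.aeval_X,
      aeval_newtonSum S (symE_zero S) isNewton_symE (Nat.succ_pos k)]
  change Function.Injective (MvPolynomial.aeval (fun k => symP S (k + 1)))
  rw [h3, AlgHom.coe_comp]
  exact Function.Injective.comp (algebraicIndependent_symE S) h1.injective

theorem linearIndependent_symPPart :
    LinearIndependent S fun l : Σ d : ℕ, d.Partition => symPPart S l.2 := by
  classical
  -- The variable X_k stands for p_{k+1}, hence the shift of the parts by one; it loses nothing
  -- because parts are positive. Distinct partitions give distinct monomials.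
  let g : (Σ d : ℕ, d.Partition) → (ℕ →₀ ℕ) := fun l =>
    Multiset.toFinsupp (l.2.parts.map fun x => x - 1)
  have hg : Function.Injective g := by
    rintro ⟨d, l⟩ ⟨d', l'⟩ h
    have h1 := Multiset.toFinsupp.injective h
    have h2 : ∀ (d : ℕ) (l : d.Partition), (l.parts.map fun x => x - 1).map (fun x => x + 1) =
        l.parts := by
      intro d l
      rw [Multiset.map_map]
      conv_rhs => rw [← Multiset.map_id l.parts]
      refine Multiset.map_congr rfl fun x hx => ?_
      have := l.parts_pos hx
      simp only [Function.comp, id]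
      omega
    have h3 : l.parts = l'.parts := by
      rw [← h2 d l, ← h2 d' l', show l.parts.map _ = l'.parts.map _ from h1]
    obtain rfl : d = d' := by rw [← l.parts_sum, ← l'.parts_sum, h3]
    rw [Nat.Partition.ext h3]
  have h1 : LinearIndependent S fun l => MvPolynomial.monomial (g l) (1 : S) := by
    have h2 := (MvPolynomial.basisMonomials ℕ S).linearIndependent.comp g hg
    simpa [Function.comp_def, MvPolynomial.coe_basisMonomials] using h2
  have h3 := h1.map' (MvPolynomial.aeval (R := S) fun k => symP S (k + 1)).toLinearMap
    (LinearMap.ker_eq_bot.2 (algebraicIndependent_symP S))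
  have h4 : (fun l : Σ d : ℕ, d.Partition => symPPart S l.2) =
      (MvPolynomial.aeval (R := S) fun k => symP S (k + 1)).toLinearMap ∘
        fun l => MvPolynomial.monomial (g l) (1 : S) := by
    funext l
    symm
    simp only [Function.comp_apply, AlgHom.toLinearMap_apply, MvPolynomial.aeval_monomial, map_one,
      one_mul, symPPart, g]
    rw [Finsupp.prod, Multiset.toFinsupp_support]
    simp only [Multiset.toFinsupp_apply]
    rw [← Finset.prod_multiset_map_count, Multiset.map_map]
    congr 1
    refine Multiset.map_congr rfl fun x hx => ?_
    have := l.2.parts_pos hx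
    simp only [Function.comp]
    congr 1
    omega
  rw [h4]
  exact h3

end Omega

/-! ### Inversions of concatenated words -/

namespace NUIO

variable {n : ℕ} (P : NUIO n)

open Classical in
/-- Contribution of the pair of letters `a … b` to the number of inversions. -/
noncomputable def pairInv (a b : Fin n) : ℕ := if P.inc.Adj a b ∧ b < a then 1 else 0

/-- Number of inversions between the letters of `v` and the letters of `w`. -/
noncomputable def crossInv (v w : List (Fin n)) : ℕ :=
  (v.map fun a => (w.map (P.pairInv a)).sum).sum

theorem inv_eq_sum (w : List (Fin n)) :
    P.inv w = ∑ i : Fin w.length, ∑ j : Fin w.length,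
      if i < j then P.pairInv (w.get i) (w.get j) else 0 := by
  classical
  rw [inv, Finset.card_filter, ← Finset.univ_product_univ, Finset.sum_product]
  refine Finset.sum_congr rfl fun i _ => Finset.sum_congr rfl fun j _ => ?_
  by_cases h : i < j <;> simp [pairInv, h]

theorem inv_nil : P.inv [] = 0 := by
  simp [inv_eq_sum]

theorem inv_cons (a : Fin n) (w : List (Fin n)) :
    P.inv (a :: w) = (w.map (P.pairInv a)).sum + P.inv w := by
  have h : (w.map (P.pairInv a)).sum = ∑ j : Fin w.length, P.pairInv a (w.get j) := by
    rw [← List.sum_ofFn]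
    congr 1
    conv_lhs => rw [← List.ofFn_get w, List.map_ofFn]
    rfl
  rw [inv_eq_sum, inv_eq_sum, h]
  simp only [List.length_cons, Fin.sum_univ_succ]
  simp

theorem inv_append (v w : List (Fin n)) :
    P.inv (v ++ w) = P.inv v + P.inv w + P.crossInv v w := by
  induction v with
  | nil => simp [inv_nil, crossInv]
  | cons a v ih =>
    rw [List.cons_append, inv_cons, inv_cons, ih, List.map_append, List.sum_append, crossInv,
      crossInv, List.map_cons, List.sum_cons]
    ring

theorem crossInv_perm {v v' w w' : List (Fin n)} (hv : v.Perm v') (hw : w.Perm w') :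
    P.crossInv v w = P.crossInv v' w' := by
  unfold crossInv
  rw [(hv.map _).sum_eq]
  congr 1
  refine List.map_congr_left fun a _ => ?_
  exact (hw.map _).sum_eq

/-- Inversions between different factors depend only on the letters of each factor, not on their
order. -/
theorem inv_replace {x x' : List (Fin n)} (h : x.Perm x') (hi : P.inv x = P.inv x')
    (v w : List (Fin n)) : P.inv (v ++ x ++ w) = P.inv (v ++ x' ++ w) := by
  rw [inv_append, inv_append, inv_append P (v ++ x'), inv_append P v x', hi,
    P.crossInv_perm (List.Perm.refl v) h, P.crossInv_perm (h.append_left v) (List.Perm.refl w)]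

theorem inv_eq_zero {w : List (Fin n)} (h : w.Pairwise fun a b => ¬ P.inc.Adj a b) :
    P.inv w = 0 := by
  induction w with
  | nil => exact P.inv_nil
  | cons a w ih =>
    rw [List.pairwise_cons] at h
    rw [inv_cons, ih h.2, add_zero, List.sum_eq_zero]
    intro x hx
    obtain ⟨b, hb, rfl⟩ := List.mem_map.1 hx
    exact if_neg fun h' => h.1 b hb h'.1

end NUIO

/-! ### The evaluation of words by type and inversions -/

namespace NUIO

variable {n : ℕ} (P : NUIO n) (μ : Fin n → ℕ)

open Classical in
/-- The weight `q ^ inv(w)` of the words of type `μ`. -/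
noncomputable def wordWeight (w : List (Fin n)) : ℚ[X] :=
  if HasType μ w then X ^ P.inv w else 0

/-- The additive map on the free algebra sending `u_w` to the weight of `w`. -/
noncomputable def wordEval : FreeAlgebra ℤ (Fin n) →+ ℚ[X] :=
  (MonoidAlgebra.liftNC (Int.castAddHom ℚ[X])
      (fun w : FreeMonoid (Fin n) => P.wordWeight μ w.toList)).comp
    (FreeAlgebra.equivMonoidAlgebraFreeMonoid (R := ℤ) (X := Fin n)).toRingEquiv.toAddEquiv.toAddMonoidHom

theorem wordEval_uWord (w : List (Fin n)) : P.wordEval μ (uWord w) = P.wordWeight μ w := by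
  have h : FreeAlgebra.equivMonoidAlgebraFreeMonoid (R := ℤ) (uWord w) =
      MonoidAlgebra.single (FreeMonoid.ofList w) 1 := by
    induction w with
    | nil =>
      rw [uWord, List.map_nil, List.prod_nil, map_one]
      rfl
    | cons a w ih =>
      have h1 : uWord (a :: w) = FreeAlgebra.ι ℤ a * uWord w := by simp [uWord]
      have h2 : FreeAlgebra.equivMonoidAlgebraFreeMonoid (FreeAlgebra.ι ℤ a) =
          MonoidAlgebra.single (FreeMonoid.of a) (1 : ℤ) := by
        simp [FreeAlgebra.equivMonoidAlgebraFreeMonoid]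
      rw [h1, map_mul, ih, h2, MonoidAlgebra.single_mul_single, one_mul]
      rfl
  change MonoidAlgebra.liftNC _ _ (FreeAlgebra.equivMonoidAlgebraFreeMonoid (uWord w)) = _
  rw [h, MonoidAlgebra.liftNC_single]
  simp

theorem uWord_append (v w : List (Fin n)) : uWord (v ++ w) = uWord v * uWord w := by
  simp [uWord]

theorem mem_span_uWord (a : FreeAlgebra ℤ (Fin n)) :
    a ∈ Submodule.span ℤ (Set.range (uWord (n := n))) := by
  induction a using FreeAlgebra.induction with
  | grade0 r =>
    rw [Algebra.algebraMap_eq_smul_one]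
    exact Submodule.smul_mem _ _ (Submodule.subset_span ⟨[], rfl⟩)
  | grade1 x => exact Submodule.subset_span ⟨[x], by simp [uWord]⟩
  | mul a b ha hb =>
    induction ha using Submodule.span_induction with
    | zero => simp
    | add a a' _ _ ha ha' =>
      rw [add_mul]
      exact Submodule.add_mem _ ha ha'
    | smul r a _ ha =>
      rw [smul_mul_assoc]
      exact Submodule.smul_mem _ r ha
    | mem a ha =>
      obtain ⟨v, rfl⟩ := ha
      induction hb using Submodule.span_induction with
      | zero => simp
      | add b b' _ _ hb hb' =>
        rw [mul_add]
        exact Submodule.add_mem _ hb hb'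
      | smul r b _ hb =>
        rw [mul_smul_comm]
        exact Submodule.smul_mem _ r hb
      | mem b hb =>
        obtain ⟨w, rfl⟩ := hb
        rw [← uWord_append]
        exact Submodule.subset_span ⟨v ++ w, rfl⟩
  | add a b ha hb => exact Submodule.add_mem _ ha hb

open Classical in
theorem wordWeight_replace {x x' : List (Fin n)} (h : x.Perm x') (hi : P.inv x = P.inv x')
    (v w : List (Fin n)) : P.wordWeight μ (v ++ x ++ w) = P.wordWeight μ (v ++ x' ++ w) := by
  have h1 : HasType μ (v ++ x ++ w) ↔ HasType μ (v ++ x' ++ w) :=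
    forall_congr' fun i => by rw [((h.append_left v).append_right w).count_eq i]
  unfold wordWeight
  rw [if_congr h1 rfl rfl, P.inv_replace h hi]

theorem wordEval_eq_zero {x x' : List (Fin n)} (h : x.Perm x') (hi : P.inv x = P.inv x')
    (a b : FreeAlgebra ℤ (Fin n)) : P.wordEval μ (a * (uWord x - uWord x') * b) = 0 := by
  induction mem_span_uWord a using Submodule.span_induction with
  | zero => simp
  | add a a' _ _ ha ha' => rw [add_mul, add_mul, map_add, ha, ha', add_zero]
  | smul r a _ ha => rw [smul_mul_assoc, smul_mul_assoc, map_zsmul, ha, smul_zero]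
  | mem a ha =>
    obtain ⟨v, rfl⟩ := ha
    induction mem_span_uWord b using Submodule.span_induction with
    | zero => simp
    | add b b' _ _ hb hb' => rw [mul_add, map_add, hb, hb', add_zero]
    | smul r b _ hb => rw [mul_smul_comm, map_zsmul, hb, smul_zero]
    | mem b hb =>
      obtain ⟨w, rfl⟩ := hb
      rw [mul_sub, sub_mul, ← uWord_append, ← uWord_append, ← uWord_append, ← uWord_append,
        map_sub, wordEval_uWord, wordEval_uWord, P.wordWeight_replace μ h hi, sub_self]

/-- Each generator is a difference of two rearrangements with equally many inversions: none for a c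
and c a, and one each for a c b (the pair c, b) and b a c (the pair b, a). -/
theorem wordEval_ideal {x : FreeAlgebra ℤ (Fin n)} (hx : x ∈ P.ideal) : P.wordEval μ x = 0 := by
  -- The evaluation is only additive, so the induction needs all two-sided multiples.
  have key : ∀ a b, P.wordEval μ (a * x * b) = 0 := by
    induction hx using TwoSidedIdeal.span_induction with
    | zero => simp
    | add x y _ _ hx hy =>
      intro a b
      rw [mul_add, add_mul, map_add, hx, hy, add_zero]
    | neg x _ hx =>
      intro a b
      rw [mul_neg, neg_mul, map_neg, hx, neg_zero]
    | left_absorb c x _ hx =>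
      intro a b
      rw [← mul_assoc, hx]
    | right_absorb c x _ hx =>
      intro a b
      rw [← mul_assoc, mul_assoc, hx]
    | mem x hx =>
      intro a b
      rcases hx with ⟨y, z, hyz, rfl⟩ | ⟨y, z, t, hyz, hzt, h1, h2, h3, rfl⟩
      · refine P.wordEval_eq_zero μ (List.Perm.swap _ _ _) ?_ a b
        have h4 : ¬ P.inc.Adj y z := fun h => h.2.1 hyz
        have h5 : ¬ P.inc.Adj z y := fun h => h.2.2 hyz
        simp [inv_cons, inv_nil, pairInv, h4, h5]
      · refine P.wordEval_eq_zero μ ?_ ?_ a b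
        · exact ((List.Perm.swap z t []).cons y).trans (List.Perm.swap z y [t])
        · have h4 : ¬ P.inc.Adj y t := fun h => h.2.1 h3
          have h5 : P.inc.Adj z y := ⟨hyz.ne', P.not_lt_of_le hyz.le, h1⟩
          have h6 : P.inc.Adj t z := ⟨hzt.ne', P.not_lt_of_le hzt.le, h2⟩
          simp [inv_cons, inv_nil, pairInv, h4, h5, h6, hyz, hzt, hyz.not_gt, hzt.not_gt]
  simpa using key 1 1

end NUIO

/-! ### Products of elementary functions and colorings -/

namespace NUIO

variable {n : ℕ} (P : NUIO n)

open Classical in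
/-- The chains of `P` with `k` elements. -/
noncomputable def chains (k : ℕ) : Finset (Finset (Fin n)) :=
  Finset.univ.filter fun C => C.card = k ∧ ∀ a ∈ C, ∀ b ∈ C, ¬ P.inc.Adj a b

theorem mem_chains {k : ℕ} {C : Finset (Fin n)} :
    C ∈ P.chains k ↔ C.card = k ∧ ∀ a ∈ C, ∀ b ∈ C, ¬ P.inc.Adj a b := by
  simp [chains]

theorem ncE_eq_sum_chains (k : ℕ) :
    P.ncE k = ∑ C ∈ P.chains k, uWord (C.sort (· ≥ ·)) := by
  classical
  symm
  refine Finset.sum_bij' (fun C _ => C.sort (· ≥ ·)) (fun w _ => w.toFinset) ?_ ?_ ?_ ?_ ?_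
  · intro C hC
    rw [mem_chains] at hC
    rw [Finset.mem_filter, mem_wordsOfLength, Finset.length_sort, isDecreasing_iff]
    refine ⟨hC.1, ?_⟩
    have h1 : (C.sort (· ≥ ·)).Pairwise (· > ·) := (Finset.sortedGT_sort C).pairwise
    refine h1.imp_of_mem fun {a b} ha hb hab => ?_
    rw [Finset.mem_sort] at ha hb
    by_contra h
    exact hC.2 a ha b hb ⟨ne_of_gt hab, P.not_lt_of_le (le_of_lt hab), h⟩
  · intro w hw
    rw [Finset.mem_filter, mem_wordsOfLength, isDecreasing_iff] at hw
    have h1 : w.Nodup := hw.2.imp fun {a b} h => (lt_of_Plt h).ne'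
    rw [mem_chains]
    refine ⟨by rw [List.toFinset_card_of_nodup h1, hw.1], fun a ha b hb hab => ?_⟩
    rw [List.mem_toFinset] at ha hb
    have h2 : w.Pairwise fun a b => ¬ P.inc.Adj a b := hw.2.imp fun {a b} h h' => h'.2.2 h
    exact h2.forall_of_forall_of_flip (fun x _ => P.inc.loopless.1 x)
      (h2.imp fun {a b} h h' => h h'.symm) ha hb hab
  · intro C hC
    exact Finset.sort_toFinset _ _
  · intro w hw
    rw [Finset.mem_filter, mem_wordsOfLength, isDecreasing_iff] at hw
    have h1 : w.Nodup := hw.2.imp fun {a b} h => (lt_of_Plt h).ne'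
    rw [List.toFinset_sort _ h1]
    exact hw.2.imp fun {a b} h => (lt_of_Plt h).le
  · intro C hC
    rfl

/-- The set of vertices using the color `r`. -/
def colorClass (κ : Fin n → Finset ℕ) (r : ℕ) : Finset (Fin n) :=
  Finset.univ.filter fun i => r ∈ κ i

theorem mem_colorClass {κ : Fin n → Finset ℕ} {r : ℕ} {i : Fin n} :
    i ∈ colorClass κ r ↔ r ∈ κ i := by
  simp [colorClass]

/-- The color classes of the colors less than `N`, listed from the largest color. -/
def colorWord (κ : Fin n → Finset ℕ) : ℕ → List (Fin n)
  | 0 => []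
  | N + 1 => (colorClass κ N).sort (· ≥ ·) ++ colorWord κ N

theorem colorWord_congr {κ κ' : Fin n → Finset ℕ} {N : ℕ}
    (h : ∀ r < N, colorClass κ r = colorClass κ' r) : colorWord κ N = colorWord κ' N := by
  induction N with
  | zero => rfl
  | succ N ih =>
    rw [colorWord, colorWord, h N (Nat.lt_succ_self N), ih fun r hr => h r (by omega)]

/-- The product of the noncommutative elementary functions `e_{m_{N-1}} ⋯ e_{m_0}`. -/
noncomputable def elemProd (m : ℕ → ℕ) : ℕ → FreeAlgebra ℤ (Fin n)
  | 0 => 1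
  | N + 1 => P.ncE (m N) * elemProd m N

open Classical in
/-- The colorings with colors less than `N` whose color classes are chains of sizes `m`. -/
noncomputable def chainColorings (m : ℕ → ℕ) (N : ℕ) : Finset (Fin n → Finset ℕ) :=
  (Fintype.piFinset fun _ : Fin n => (Finset.range N).powerset).filter
    fun κ => ∀ r < N, colorClass κ r ∈ P.chains (m r)

theorem mem_chainColorings {m : ℕ → ℕ} {N : ℕ} {κ : Fin n → Finset ℕ} :
    κ ∈ P.chainColorings m N ↔ (∀ i, ∀ r ∈ κ i, r < N) ∧
      ∀ r < N, colorClass κ r ∈ P.chains (m r) := by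
  simp [chainColorings, Finset.subset_iff]

theorem elemProd_eq_sum (m : ℕ → ℕ) (N : ℕ) :
    P.elemProd m N = ∑ κ ∈ P.chainColorings m N, uWord (colorWord κ N) := by
  classical
  induction N with
  | zero =>
    have h : P.chainColorings m 0 = {fun _ => ∅} := by
      ext κ
      rw [mem_chainColorings, Finset.mem_singleton]
      constructor
      · rintro ⟨h, -⟩
        funext i
        exact Finset.eq_empty_of_forall_notMem fun r hr => Nat.not_lt_zero _ (h i r hr)
      · rintro rfl
        simp
    rw [h, Finset.sum_singleton]
    rfl
  | succ N ih =>
    rw [elemProd, ih, ncE_eq_sum_chains, Finset.sum_mul_sum, ← Finset.sum_product']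
    have hN : ∀ (C : Finset (Fin n)) (κ : Fin n → Finset ℕ), (∀ i, ∀ r ∈ κ i, r < N) →
        colorClass (fun i => if i ∈ C then insert N (κ i) else κ i) N = C := by
      intro C κ h
      ext i
      rw [mem_colorClass]
      by_cases hi : i ∈ C
      · simp [hi]
      · simp only [hi, if_false, iff_false]
        exact fun h' => lt_irrefl _ (h i N h')
    have hr : ∀ (C : Finset (Fin n)) (κ : Fin n → Finset ℕ), ∀ r < N,
        colorClass (fun i => if i ∈ C then insert N (κ i) else κ i) r = colorClass κ r := by
      intro C κ r hr
      ext i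
      rw [mem_colorClass, mem_colorClass]
      split_ifs
      · simp [hr.ne]
      · rfl
    -- The leftmost factor e_{m_N} chooses the class of the largest color N; the remaining factors
    -- choose the coloring by smaller colors.
    refine Finset.sum_bij' (fun x _ => fun i => if i ∈ x.1 then insert N (x.2 i) else x.2 i)
      (fun κ _ => (colorClass κ N, fun i => (κ i).erase N)) ?_ ?_ ?_ ?_ ?_
    · rintro ⟨C, κ⟩ h
      rw [Finset.mem_product, mem_chainColorings] at h
      rw [mem_chainColorings]
      refine ⟨fun i r h' => ?_, fun r hr' => ?_⟩
      · simp only at h'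
        split_ifs at h'
        · rcases Finset.mem_insert.1 h' with rfl | h'
          · exact Nat.lt_succ_self _
          · exact (h.2.1 i r h').trans (Nat.lt_succ_self _)
        · exact (h.2.1 i r h').trans (Nat.lt_succ_self _)
      · rcases Nat.lt_succ_iff_lt_or_eq.1 hr' with h' | rfl
        · rw [hr _ _ _ h']
          exact h.2.2 r h'
        · rw [hN _ _ h.2.1]
          exact h.1
    · intro κ h
      rw [mem_chainColorings] at h
      rw [Finset.mem_product, mem_chainColorings]
      refine ⟨h.2 N (Nat.lt_succ_self N), fun i r h' => ?_, fun r hr' => ?_⟩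
      · rw [Finset.mem_erase] at h'
        have := h.1 i r h'.2
        omega
      · convert h.2 r (by omega) using 1
        ext i
        simp [mem_colorClass, hr'.ne]
    · rintro ⟨C, κ⟩ h
      rw [Finset.mem_product, mem_chainColorings] at h
      simp only [Prod.mk.injEq]
      refine ⟨hN C κ h.2.1, ?_⟩
      funext i
      have h1 : N ∉ κ i := fun h' => lt_irrefl _ (h.2.1 i N h')
      split_ifs
      · exact Finset.erase_insert h1
      · exact Finset.erase_eq_of_notMem h1
    · intro κ h
      funext i
      simp only [mem_colorClass]
      split_ifs with h1
      · exact Finset.insert_erase h1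
      · exact Finset.erase_eq_of_notMem h1
    · rintro ⟨C, κ⟩ h
      rw [Finset.mem_product, mem_chainColorings] at h
      rw [colorWord, hN _ _ h.2.1, colorWord_congr (hr C κ), uWord_append]

theorem count_colorWord (κ : Fin n → Finset ℕ) (N : ℕ) (i : Fin n) :
    (colorWord κ N).count i = ((κ i).filter (· < N)).card := by
  induction N with
  | zero => simp [colorWord]
  | succ N ih =>
    have h1 : ((colorClass κ N).sort (· ≥ ·)).count i = if N ∈ κ i then 1 else 0 := by
      split_ifs with h
      · exact List.count_eq_one_of_mem (Finset.sort_nodup _ _)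
          ((Finset.mem_sort _).2 (mem_colorClass.2 h))
      · exact List.count_eq_zero_of_not_mem fun h' =>
          h (mem_colorClass.1 ((Finset.mem_sort _).1 h'))
    rw [colorWord, List.count_append, ih, h1]
    have h2 : (κ i).filter (· < N + 1) =
        (κ i).filter (· < N) ∪ (κ i).filter (· = N) := by
      ext r
      simp only [Finset.mem_filter, Finset.mem_union, Nat.lt_succ_iff_lt_or_eq]
      tauto
    rw [h2, Finset.card_union_of_disjoint, Finset.filter_eq', add_comm]
    · split_ifs <;> simp
    · refine Finset.disjoint_filter.2 fun r _ h => ?_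
      omega

end NUIO

/-! ### Coefficients of the chromatic quasisymmetric function -/

namespace NUIO

variable {n : ℕ} (P : NUIO n)

theorem sum_map_sort {M : Type*} [AddCommMonoid M] (C : Finset (Fin n)) (f : Fin n → M) :
    ((C.sort (· ≥ ·)).map f).sum = ∑ a ∈ C, f a := by
  rw [Finset.sum, ← Finset.sort_eq C (· ≥ ·), Multiset.map_coe, Multiset.sum_coe]

theorem sum_map_eq_sum_count (w : List (Fin n)) (f : Fin n → ℕ) :
    (w.map f).sum = ∑ i, w.count i * f i := by
  rw [Finset.sum_list_map_count]
  refine Finset.sum_subset (Finset.subset_univ _) fun i _ hi => ?_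
  rw [List.mem_toFinset] at hi
  simp [List.count_eq_zero_of_not_mem hi]

theorem card_ascents_succ (A B : Finset ℕ) (N : ℕ) :
    ((A ×ˢ B).filter fun c => c.1 < c.2 ∧ c.2 < N + 1).card =
      ((A ×ˢ B).filter fun c => c.1 < c.2 ∧ c.2 < N).card +
        if N ∈ B then (A.filter (· < N)).card else 0 := by
  have h1 : ((A ×ˢ B).filter fun c => c.1 < c.2 ∧ c.2 < N + 1) =
      ((A ×ˢ B).filter fun c => c.1 < c.2 ∧ c.2 < N) ∪ A.filter (· < N) ×ˢ B.filter (· = N) := by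
    ext ⟨r, s⟩
    simp only [Finset.mem_filter, Finset.mem_union, Finset.mem_product]
    constructor
    · rintro ⟨⟨h1, h2⟩, h3, h4⟩
      rcases Nat.lt_succ_iff_lt_or_eq.1 h4 with h | h
      · exact Or.inl ⟨⟨h1, h2⟩, h3, h⟩
      · exact Or.inr ⟨⟨h1, h ▸ h3⟩, h2, h⟩
    · rintro (⟨⟨h1, h2⟩, h3, h4⟩ | ⟨⟨h1, h3⟩, h2, h4⟩)
      · exact ⟨⟨h1, h2⟩, h3, by omega⟩
      · exact ⟨⟨h1, h2⟩, by omega, by omega⟩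
  rw [h1, Finset.card_union_of_disjoint, Finset.card_product, Finset.filter_eq']
  · split_ifs <;> simp
  · refine Finset.disjoint_left.2 fun c hc hc' => ?_
    have h2 := (Finset.mem_filter.1 hc).2.2
    have h3 := (Finset.mem_filter.1 (Finset.mem_product.1 hc').2).2
    omega

-- Larger colors come first in the word, so an ascent (i < j with colors r < s) places j before i
-- and becomes an inversion. Within a color class there are none, as it is a chain.
open Classical in
theorem inv_colorWord (κ : Fin n → Finset ℕ) (N : ℕ)
    (h : ∀ r < N, ∀ a ∈ colorClass κ r, ∀ b ∈ colorClass κ r, ¬ P.inc.Adj a b) :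
    P.inv (colorWord κ N) = ∑ p : Fin n × Fin n with P.inc.Adj p.1 p.2 ∧ p.1 < p.2,
      ((κ p.1 ×ˢ κ p.2).filter fun c => c.1 < c.2 ∧ c.2 < N).card := by
  induction N with
  | zero => simp [colorWord, inv_nil]
  | succ N ih =>
    have h1 : P.inv ((colorClass κ N).sort (· ≥ ·)) = 0 := by
      refine P.inv_eq_zero (List.pairwise_of_forall_mem_list fun a ha b hb => ?_)
      exact h N (Nat.lt_succ_self N) a ((Finset.mem_sort _).1 ha) b ((Finset.mem_sort _).1 hb)
    simp only [card_ascents_succ, Finset.sum_add_distrib]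
    rw [colorWord, inv_append, h1, zero_add, ih fun r hr => h r (by omega)]
    congr 1
    rw [crossInv, sum_map_sort, Finset.sum_filter, ← Finset.univ_product_univ,
      Finset.sum_product_right, colorClass, Finset.sum_filter]
    refine Finset.sum_congr rfl fun j _ => ?_
    rw [sum_map_eq_sum_count]
    split_ifs with hj
    · refine Finset.sum_congr rfl fun i _ => ?_
      rw [count_colorWord, pairInv, P.inc.adj_comm j i, mul_ite, mul_one, mul_zero]
    · simp

theorem ascents_eq_inv_colorWord {κ : Fin n → Finset ℕ} {N : ℕ} (hN : ∀ i, ∀ r ∈ κ i, r < N)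
    (h : ∀ r < N, ∀ a ∈ colorClass κ r, ∀ b ∈ colorClass κ r, ¬ P.inc.Adj a b) :
    ascents P.inc κ = P.inv (colorWord κ N) := by
  classical
  rw [inv_colorWord P κ N h, ascents]
  refine Finset.sum_congr (by congr) fun p _ => ?_
  congr 1
  refine Finset.filter_congr fun c hc => ?_
  rw [and_iff_left (hN _ _ (Finset.mem_product.1 hc).2)]

theorem colorExponent_apply (κ : Fin n → Finset ℕ) (r : ℕ) :
    colorExponent κ r = (colorClass κ r).card := by
  simp [colorExponent, Finsupp.finsetSum_apply, Finsupp.single_apply, colorClass]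

variable (μ : Fin n → ℕ)

/-- A coloring is proper exactly when its color classes are chains, and its monomial records their
sizes. The evaluation selects type μ and turns inversions into ascents. -/
theorem wordEval_elemProd (m : ℕ →₀ ℕ) {N : ℕ} (hN : ∀ r, m r ≠ 0 → r < N) :
    P.wordEval μ (P.elemProd m N) = MvPowerSeries.coeff m (chromaticX P.inc μ) := by
  classical
  rw [elemProd_eq_sum, map_sum]
  have h1 : ∀ κ ∈ P.chainColorings m N, P.wordEval μ (uWord (colorWord κ N)) =
      if ∀ i, (κ i).card = μ i then X ^ ascents P.inc κ else 0 := by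
    intro κ hκ
    rw [mem_chainColorings] at hκ
    rw [wordEval_uWord, wordWeight, P.ascents_eq_inv_colorWord hκ.1
      fun r hr => (P.mem_chains.1 (hκ.2 r hr)).2]
    refine if_congr (forall_congr' fun i => ?_) rfl rfl
    rw [count_colorWord, Finset.filter_true_of_mem (hκ.1 i)]
  rw [Finset.sum_congr rfl h1, ← Finset.sum_filter]
  change _ = ∑ κ ∈ (Fintype.piFinset fun _ : Fin n => m.support.powerset).filter
    (fun κ => IsProperMultiColoring P.inc μ κ ∧ colorExponent κ = m), X ^ ascents P.inc κ
  refine Finset.sum_congr ?_ fun _ _ => rfl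
  ext κ
  rw [Finset.mem_filter, Finset.mem_filter, mem_chainColorings, Fintype.mem_piFinset]
  simp only [Finset.mem_powerset, Finset.subset_iff, Finsupp.mem_support_iff]
  constructor
  · rintro ⟨⟨h2, h3⟩, h4⟩
    have h5 : ∀ i, ∀ r ∈ κ i, m r ≠ 0 := by
      intro i r hr
      rw [← (P.mem_chains.1 (h3 r (h2 i r hr))).1]
      exact Finset.card_ne_zero_of_mem (mem_colorClass.2 hr)
    refine ⟨h5, ⟨h4, fun i j hij => Finset.disjoint_left.2 fun r hi hj => ?_⟩, ?_⟩
    · exact (P.mem_chains.1 (h3 r (h2 i r hi))).2 i (mem_colorClass.2 hi) j (mem_colorClass.2 hj) hij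
    · ext r
      rw [colorExponent_apply]
      by_cases hr : r < N
      · exact (P.mem_chains.1 (h3 r hr)).1
      · have h6 : m r = 0 := by
          by_contra h
          exact hr (hN r h)
        rw [h6, Finset.card_eq_zero]
        exact Finset.eq_empty_of_forall_notMem fun i hi => hr (h2 i r (mem_colorClass.1 hi))
  · rintro ⟨h2, ⟨h3, h4⟩, h5⟩
    refine ⟨⟨fun i r hr => hN r (h2 i hr), fun r hr => P.mem_chains.2 ⟨?_, ?_⟩⟩, h3⟩
    · rw [← colorExponent_apply, h5]
    · intro a ha b hb hab
      exact Finset.disjoint_left.1 (h4 a b hab) (mem_colorClass.1 ha) (mem_colorClass.1 hb)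

theorem coeff_chromaticX_eq_zero {m : ℕ →₀ ℕ} (hm : m.degree ≠ ∑ i, μ i) :
    MvPowerSeries.coeff m (chromaticX P.inc μ) = 0 := by
  classical
  refine Finset.sum_eq_zero fun κ hκ => absurd ?_ hm
  obtain ⟨-, ⟨h1, -⟩, rfl⟩ := Finset.mem_filter.1 hκ
  simp [colorExponent, h1]

/-! ### Products of sums of good words -/

theorem sum_wordsOfLength_add {M : Type*} [AddCommMonoid M] (f : List (Fin n) → M) (k l : ℕ) :
    ∑ w ∈ wordsOfLength n (k + l), f w =
      ∑ v ∈ wordsOfLength n k, ∑ w ∈ wordsOfLength n l, f (v ++ w) := by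
  induction k generalizing f with
  | zero => simp [wordsOfLength_zero]
  | succ k ih =>
    rw [Nat.add_right_comm, sum_wordsOfLength_succ, sum_wordsOfLength_succ]
    refine Finset.sum_congr rfl fun a _ => ?_
    rw [ih]
    rfl

open Classical in
theorem prod_goodWords (L : List ℕ) :
    (L.map fun k => ∑ w ∈ P.goodWords k, uWord w).prod =
      ∑ w ∈ (wordsOfLength n L.sum).filter
        (fun w => ∀ s ∈ L.splitLengths w, P.NoDescents s ∧ P.NoNontrivialMaxima s), uWord w := by
  induction L with
  | nil => simp [wordsOfLength_zero, uWord]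
  | cons k L ih =>
    rw [List.map_cons, List.prod_cons, ih, goodWords, List.sum_cons, Finset.sum_filter,
      Finset.sum_filter, Finset.sum_filter, sum_wordsOfLength_add, Finset.sum_mul_sum]
    refine Finset.sum_congr rfl fun v hv => Finset.sum_congr rfl fun w _ => ?_
    rw [mem_wordsOfLength] at hv
    subst hv
    simp only [List.splitLengths_cons, List.take_left, List.drop_left,
      List.mem_cons, forall_eq_or_imp]
    by_cases h1 : P.NoDescents v ∧ P.NoNontrivialMaxima v
    · by_cases h2 : ∀ s ∈ L.splitLengths w, P.NoDescents s ∧ P.NoNontrivialMaxima s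
      · rw [if_pos h1, if_pos h2, if_pos ⟨h1, h2⟩, uWord_append]
      · rw [if_neg h2, mul_zero, if_neg fun h => h2 h.2]
    · rw [if_neg h1, zero_mul, if_neg fun h => h1 h.1]

theorem wordEval_prod_goodWords {d : ℕ} (l : d.Partition) :
    P.wordEval μ ((l.parts.sort (· ≥ ·)).map fun k => ∑ w ∈ P.goodWords k, uWord w).prod =
      P.powerCoeff μ l := by
  classical
  have h : (l.parts.sort (· ≥ ·)).sum = d := by
    rw [← Multiset.sum_coe, Multiset.sort_eq, l.parts_sum]
  rw [prod_goodWords, h, map_sum, powerCoeff, splitWords]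
  simp only [wordEval_uWord, wordWeight]
  rw [← Finset.sum_filter, Finset.filter_filter]
  refine Finset.sum_congr ?_ fun _ _ => rfl
  ext w
  simp only [Finset.mem_filter]
  tauto

theorem powerCoeff_eq_zero {d : ℕ} (l : d.Partition) (hd : d ≠ ∑ i, μ i) :
    P.powerCoeff μ l = 0 := by
  classical
  refine Finset.sum_eq_zero fun w hw => absurd ?_ hd
  obtain ⟨h1, h2, -⟩ := Finset.mem_filter.1 hw
  rw [← mem_wordsOfLength.1 h1, ← Finset.sum_congr rfl fun i _ => h2 i]
  have h3 := sum_map_eq_sum_count w fun _ => 1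
  simpa using h3

end NUIO

/-! ### Evaluation on the commutative algebra of elementary functions -/

namespace NUIO

variable {n : ℕ} (P : NUIO n)

theorem ringCon_mk_eq_zero {x : FreeAlgebra ℤ (Fin n)} :
    P.ideal.ringCon.mk' x = 0 ↔ x ∈ P.ideal := by
  rw [TwoSidedIdeal.mem_iff, ← map_zero P.ideal.ringCon.mk']
  exact RingCon.eq _

theorem commute_mk {a c : Fin n} (h : P.lt a c) :
    Commute (P.ideal.ringCon.mk' (FreeAlgebra.ι ℤ a)) (P.ideal.ringCon.mk' (FreeAlgebra.ι ℤ c)) := by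
  have h1 : uWord [a, c] - uWord [c, a] ∈ P.ideal :=
    TwoSidedIdeal.subset_span (Or.inl ⟨a, c, h, rfl⟩)
  rw [← ringCon_mk_eq_zero, map_sub, sub_eq_zero] at h1
  simpa [uWord, Commute, SemiconjBy] using h1

theorem triple_mk {a b c : Fin n} (hab : a < b) (hbc : b < c) (h1 : ¬ P.lt a b) (h2 : ¬ P.lt b c)
    (h3 : P.lt a c) :
    P.ideal.ringCon.mk' (FreeAlgebra.ι ℤ a) * P.ideal.ringCon.mk' (FreeAlgebra.ι ℤ c) *
        P.ideal.ringCon.mk' (FreeAlgebra.ι ℤ b) =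
      P.ideal.ringCon.mk' (FreeAlgebra.ι ℤ b) * P.ideal.ringCon.mk' (FreeAlgebra.ι ℤ a) *
        P.ideal.ringCon.mk' (FreeAlgebra.ι ℤ c) := by
  have h4 : uWord [a, c, b] - uWord [b, a, c] ∈ P.ideal :=
    TwoSidedIdeal.subset_span (Or.inr ⟨a, b, c, hab, hbc, h1, h2, h3, rfl⟩)
  rw [← ringCon_mk_eq_zero, map_sub, sub_eq_zero] at h4
  simpa [uWord, mul_assoc] using h4

theorem ncP_sub_mem_ideal {k : ℕ} (hk : 1 ≤ k) :
    P.ncP k - ∑ w ∈ P.goodWords k, uWord w ∈ P.ideal := by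
  rw [← ringCon_mk_eq_zero, map_sub, sub_eq_zero, map_sum]
  exact P.map_ncP _ (fun a c h => P.commute_mk h) hk

/-- The elementary functions and the sums of good words satisfy Newton's identities. -/
theorem isNewton_goodSum {R : Type*} [Ring R] (u : Fin n → R)
    (hu : ∀ a c, P.lt a c → Commute (u a) (u c)) :
    IsNewton (P.elemSum u n) (wordSum u (P.goodWeight n)) := by
  intro k
  have h1 := congrArg (PowerSeries.coeff k) (P.goodSeries_mul_decSeries u hu n le_rfl)
  rw [PowerSeries.coeff_mul, Finset.Nat.sum_antidiagonal_eq_sum_range_succ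
    (fun i j => PowerSeries.coeff i _ * PowerSeries.coeff j _), Finset.sum_range_succ'] at h1
  have h2 : P.goodWeight n [] = 0 := if_neg fun h => h.1 rfl
  simp only [coeff_wordSeries, wordSum_zero, h2, zero_smul, zero_mul, add_zero, map_neg, eulerD,
    PowerSeries.coeff_mk] at h1
  have h3 : (k : R) * P.elemSum u n k =
      (-1) ^ k * ((k : R) * wordSum u (P.decWeight n) k) := by
    rw [elemSum]
    rcases neg_one_pow_eq_or R k with h | h <;> rw [h] <;> noncomm_ring
  rw [h3, ← neg_neg ((k : R) * wordSum u (P.decWeight n) k), ← h1, mul_neg, Finset.mul_sum,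
    ← Finset.sum_neg_distrib]
  refine Finset.sum_congr rfl fun i hi => ?_
  obtain ⟨j, rfl⟩ : ∃ j, k = j + (i + 1) := ⟨k - (i + 1), by
    have := Finset.mem_range.1 hi
    omega⟩
  rw [Nat.add_sub_cancel, elemSum, pow_add, pow_succ]
  rcases neg_one_pow_eq_or R i with h | h <;> rcases neg_one_pow_eq_or R j with h' | h' <;>
    rw [h, h'] <;> noncomm_ring

variable (μ : Fin n → ℕ)

/-- The evaluation of words factors through the quotient by the ideal. -/
theorem exists_wordEval_quotient :
    ∃ φ : P.ideal.ringCon.Quotient →+ ℚ[X], ∀ x, φ (P.ideal.ringCon.mk' x) = P.wordEval μ x := by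
  have hs : Function.Surjective P.ideal.ringCon.mk' := RingCon.mk'_surjective _
  have h1 : ∀ x y, P.ideal.ringCon.mk' x = P.ideal.ringCon.mk' y →
      P.wordEval μ x = P.wordEval μ y := by
    intro x y h
    rw [← sub_eq_zero, ← map_sub, ringCon_mk_eq_zero] at h
    rw [← sub_eq_zero, ← map_sub, P.wordEval_ideal μ h]
  refine ⟨AddMonoidHom.mk' (fun x => P.wordEval μ (Function.surjInv hs x)) fun x y => ?_,
    fun x => h1 _ _ (Function.surjInv_eq hs _)⟩
  rw [← map_add]
  apply h1
  rw [map_add, Function.surjInv_eq hs, Function.surjInv_eq hs, Function.surjInv_eq hs]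

/-- A commutative model of the elementary functions modulo the ideal, on which the coefficients
of the chromatic quasisymmetric function and the power sum coefficients are evaluations. -/
theorem exists_evaluation :
    ∃ (A : Type) (_ : CommRing A) (e p : ℕ → A) (Ψ : A →+ ℚ[X]), e 0 = 1 ∧ IsNewton e p ∧
      (∀ m : ℕ →₀ ℕ, Ψ (m.prod fun _ k => e k) = MvPowerSeries.coeff m (chromaticX P.inc μ)) ∧
      ∀ (d : ℕ) (l : d.Partition), Ψ (l.parts.map p).prod = P.powerCoeff μ l := by
  let π := P.ideal.ringCon.mk'
  let u : Fin n → P.ideal.ringCon.Quotient := fun i => π (FreeAlgebra.ι ℤ i)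
  have hC : ∀ a c, P.lt a c → Commute (u a) (u c) := fun a c h => P.commute_mk h
  have hT : ∀ a b c, a < b → b < c → ¬ P.lt a b → ¬ P.lt b c → P.lt a c →
      u a * u c * u b = u b * u a * u c := fun a b c => P.triple_mk
  -- The quotient itself need not be commutative; only the subring generated by the elementary
  -- functions is used as A.
  have hcomm := Subring.isMulCommutative_closure (s := Set.range (P.elemSum u n)) (by
    rintro _ ⟨k, rfl⟩ _ ⟨l, rfl⟩
    exact P.commute_elemSum_elemSum u hC hT k l)
  let A := Subring.closure (Set.range (P.elemSum u n))
  let _ : CommRing A := { (inferInstance : Ring A) with mul_comm := hcomm.is_comm.comm }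
  let e : ℕ → A := fun k => ⟨P.elemSum u n k, Subring.subset_closure ⟨k, rfl⟩⟩
  have he0 : e 0 = 1 := Subtype.ext (P.elemSum_zero_right u n)
  obtain ⟨φ, hφ⟩ := P.exists_wordEval_quotient μ
  have hp : ∀ k, 0 < k → (newtonSum e k).val = π (∑ w ∈ P.goodWords k, uWord w) := by
    intro k hk
    obtain ⟨k, rfl⟩ : ∃ j, k = j + 1 := ⟨k - 1, by omega⟩
    rw [map_sum, P.sum_goodWords π (Nat.succ_pos k)]
    have h1 := (isNewton_newtonSum e he0).map A.subtype
    -- Newton's identities determine the power sums from the elementary functions, so the good-word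
    -- sums lie in the commutative subring.
    exact h1.unique (P.isNewton_goodSum u hC) (P.elemSum_zero_right u n) k
  have he : ∀ k, (e k).val = π (P.ncE k) := fun k => (P.map_ncE π k).symm
  refine ⟨A, inferInstance, e, newtonSum e, φ.comp A.subtype.toAddMonoidHom, he0,
    isNewton_newtonSum e he0, fun m => ?_, fun d l => ?_⟩
  · have h1 : ∀ N, (∏ r ∈ Finset.range N, e (m r)).val = π (P.elemProd m N) := by
      intro N
      induction N with
      | zero => exact (map_one π).symm
      | succ N ih =>
        rw [Finset.prod_range_succ_comm, elemProd, map_mul, ← ih, ← he]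
        rfl
    obtain ⟨N, hN⟩ : ∃ N, ∀ r, m r ≠ 0 → r < N :=
      ⟨m.support.sup id + 1, fun r hr => Nat.lt_succ_of_le
        (Finset.le_sup (f := id) (Finsupp.mem_support_iff.2 hr))⟩
    have h2 : (m.prod fun _ k => e k) = ∏ r ∈ Finset.range N, e (m r) :=
      Finsupp.prod_of_support_subset _
        (fun r hr => Finset.mem_range.2 (hN r (Finsupp.mem_support_iff.1 hr))) _ fun _ _ => he0
    rw [← P.wordEval_elemProd μ m hN, ← hφ, h2]
    exact congrArg φ (h1 N)
  · have h1 : ∀ L : List ℕ, (∀ x ∈ L, 0 < x) → ((L.map (newtonSum e)).prod).val =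
        π (L.map fun k => ∑ w ∈ P.goodWords k, uWord w).prod := by
      intro L
      induction L with
      | nil => exact fun _ => (map_one π).symm
      | cons k L ih =>
        intro h
        rw [List.map_cons, List.map_cons, List.prod_cons, List.prod_cons, map_mul,
          ← ih fun x hx => h x (List.mem_cons_of_mem _ hx), ← hp k (h k List.mem_cons_self)]
        rfl
    have h2 : (l.parts.map (newtonSum e)).prod =
        ((l.parts.sort (· ≥ ·)).map (newtonSum e)).prod := by
      conv_lhs => rw [← Multiset.sort_eq l.parts (· ≥ ·)]
      rw [Multiset.map_coe, Multiset.prod_coe]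
    rw [← P.wordEval_prod_goodWords μ l, ← hφ, h2]
    exact congrArg φ (h1 _ fun x hx => l.parts_pos ((Multiset.mem_sort _).1 hx))

end NUIO

/-! ### Symmetry, the power sum expansion and its uniqueness -/

theorem NUIO.isSymmetricFunction_chromaticX {n : ℕ} (P : NUIO n) (μ : Fin n → ℕ) :
    IsSymmetricFunction (chromaticX P.inc μ) := by
  refine ⟨⟨∑ i, μ i, fun m hm => P.coeff_chromaticX_eq_zero μ hm.ne'⟩, fun σ m => ?_⟩
  obtain ⟨A, _, e, p, Ψ, -, -, h, -⟩ := P.exists_evaluation μ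
  -- Permuting the variables only permutes the factors of a product in the commutative ring A.
  rw [← h, ← h, Finsupp.equivMapDomain_eq_mapDomain, Finsupp.prod_mapDomain_index_inj σ.injective]

theorem NUIO.omega_chromaticX {n : ℕ} (P : NUIO n) (μ : Fin n → ℕ) :
    omega ℚ[X] (chromaticX P.inc μ) =
      ∑ l : (∑ i, μ i).Partition, (C (1 / (zPart l : ℚ)) * P.powerCoeff μ l) • symPPart ℚ[X] l := by
  obtain ⟨A, _, e, p, Ψ, h0, hN, he, hp⟩ := P.exists_evaluation μ
  have h1 : chromaticX P.inc μ = elemSeries e Ψ (∑ i, μ i) 1 := by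
    ext1 m
    rw [coeff_elemSeries, one_mul, he]
    split_ifs with hm
    · rfl
    · exact P.coeff_chromaticX_eq_zero μ hm
  rw [h1, elemSeries_eq_sum e p Ψ h0 hN]
  simp only [← smul_assoc, one_mul]
  rw [omega_sum ℚ[X] _ (fun s hs => (mem_partMultisets.1 hs).2), sum_partMultisets]
  refine Finset.sum_congr rfl fun l _ => ?_
  -- The sign from the Cauchy expansion meets the same sign from ω.
  rw [hp, symPPart, smul_mul_assoc, mul_right_comm, partSign_mul_self, one_mul, one_div,
    Polynomial.smul_eq_C_mul]
  rfl

theorem mainTheorem7 {n : ℕ} (P : NUIO n) :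
    (∀ k : ℕ, 1 ≤ k → P.ncP k - ∑ w ∈ P.goodWords k, uWord w ∈ P.ideal) ∧
    ∀ μ : Fin n → ℕ,
      IsSymmetricFunction (chromaticX P.inc μ) ∧
      omega ℚ[X] (chromaticX P.inc μ) =
        ∑ l : (∑ i, μ i).Partition,
          (C (1 / (zPart l : ℚ)) * P.powerCoeff μ l) • symPPart ℚ[X] l ∧
      ∀ b : (Σ d : ℕ, d.Partition) →₀ ℚ[X],
        omega ℚ[X] (chromaticX P.inc μ) =
          b.sum (fun l c => (C (1 / (zPart l.2 : ℚ)) * c) • symPPart ℚ[X] l.2) →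
        ∀ (d : ℕ) (l : d.Partition), b ⟨d, l⟩ = P.powerCoeff μ l := by
  classical
  refine ⟨fun k hk => P.ncP_sub_mem_ideal hk, fun μ =>
    ⟨P.isSymmetricFunction_chromaticX μ, P.omega_chromaticX μ, fun b hb d l => ?_⟩⟩
  let T₀ : Finset (Σ d : ℕ, d.Partition) :=
    (Finset.univ : Finset (∑ i, μ i).Partition).map (Function.Embedding.sigmaMk _)
  -- One finite index set for both expansions, containing the partition under consideration; outside
  -- size ∑ μ_i the word coefficients vanish.
  let T : Finset (Σ d : ℕ, d.Partition) := insert ⟨d, l⟩ (b.support ∪ T₀)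
  have h1 : b.sum (fun l c => (C (1 / (zPart l.2 : ℚ)) * c) • symPPart ℚ[X] l.2) =
      ∑ l ∈ T, (C (1 / (zPart l.2 : ℚ)) * b l) • symPPart ℚ[X] l.2 :=
    Finsupp.sum_of_support_subset _
      (Finset.subset_union_left.trans (Finset.subset_insert _ _)) _ fun _ _ => by simp
  have h2 : ∑ l : (∑ i, μ i).Partition,
        (C (1 / (zPart l : ℚ)) * P.powerCoeff μ l) • symPPart ℚ[X] l =
      ∑ l ∈ T, (C (1 / (zPart l.2 : ℚ)) * P.powerCoeff μ l.2) • symPPart ℚ[X] l.2 := by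
    rw [← Finset.sum_subset (s₁ := T₀) (Finset.subset_union_right.trans (Finset.subset_insert _ _))]
    · rw [Finset.sum_map]
      rfl
    · rintro ⟨d, l⟩ _ hl
      rw [P.powerCoeff_eq_zero μ l, mul_zero, zero_smul]
      rintro rfl
      exact hl (Finset.mem_map_of_mem _ (Finset.mem_univ l))
  rw [P.omega_chromaticX μ, h1, h2, ← sub_eq_zero, ← Finset.sum_sub_distrib] at hb
  simp only [← sub_smul] at hb
  have h3 := linearIndependent_iff'.1 (linearIndependent_symPPart ℚ[X]) T _ hb ⟨d, l⟩
    (Finset.mem_insert_self _ _)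
  rw [← mul_sub, mul_eq_zero, C_eq_zero, one_div, inv_eq_zero, Nat.cast_eq_zero] at h3
  have h4 : zPart l ≠ 0 := (zMultiset_pos fun x hx => l.parts_pos hx).ne'
  exact (sub_eq_zero.1 (h3.resolve_left h4)).symm
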